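/- Let $(X,\mathsf d)$ be a complete metric space with a Hausdorff topology $\sigma$ such that $\mathsf d$ is sequentially lower semicontinuous on $X\times X$ for $\sigma\times\sigma$, and such that for every $\sigma$-open $U$ and $x\in U$ there are a $\sigma$-open $V\ni x$ and $\delta>0$ with $\{y:\mathsf d(y,V)<\delta\}\subset U$. Let $\phi:X\to(-\infty,\infty]$ be proper and satisfy the LSCC property: - $\liminf_n\phi(u_n)\ge\phi(u)$ whenever $u_n\to u$ in $\sigma$ and $(u_n)$ is $\mathsf d$-bounded; - every $\mathsf d$-bounded sequence with $\sup_n\phi(u_n)<\infty$ has a $\sigma$-convergent subsequence; - there are $u_*\in X$ and $A,B\ge 0$ with $\phi(u)\ge -B\,\mathsf d^2(u,v)-B\,\mathsf d^2(v,u_*)-A$ for all $u,v\in X$. Write $\mathrm{AC}^p(I;(X,\delta))$ for the curves $u:I\to X$ on an interval $I$ for which some $m\in L^p(I)$ satisfies $\delta(u(s),u(t))\le\int_s^t m\,dr$ for all $s\le t$ in $I$ (with $\mathrm{AC}=\mathrm{AC}^1$ and $\delta=\mathsf d$ if omitted), and $|u'|_\delta(t)=\lim_{s\to t}\delta(u(s),u(t))/|s-t|$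 for the metric derivative, $|u'|=|u'|_{\mathsf d}$. Let $\varepsilon>0$ with $B\le\frac1{16\varepsilon}$, let $\mu_\varepsilon=\varepsilon^{-1}e^{-t/\varepsilon}\,dt$ on $(0,\infty)$, and set $$V_\varepsilon(x)=\inf\Big\{\int_0^\infty\big(\tfrac\varepsilon2|u'|^2(t)+\phi(u(t))\big)\,d\mu_\varepsilon(t)\;:\;u\in \mathrm{AC}^2_{\rm loc}([0,\infty);X),\ u(0)=x,\ \int_0^\infty|u'|^2\,d\mu_\varepsilon<\infty\Big\},$$ $G_\varepsilon(x)=\sqrt{2(\phi(x)-V_\varepsilon(x))/\varepsilon}$ if $V_\varepsilon(x)<\infty$, and $G_\varepsilon(x)=\infty$ otherwise. Let $\mathsf d_\phi$ be the Finsler extended distance $$\mathsf d_\phi(x,y)=\inf\Big\{\int_a^b(\phi(\vartheta(t))\vee1)^{1/2}\,|\vartheta'|(t)\,dt\;:\;\vartheta\in \mathrm{AC}([a,b];X),\ \vartheta(a)=x,\ \vartheta(b)=y\Big\},$$ with $\inf\emptyset=\infty$. In integrals and products, $\infty\cdot0=0$. Then: 1. For all $(x_n)_n$ and $x$ in $X$,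 $\mathsf d_\phi(x_n,x)\to0$ implies $V_\varepsilon(x_n)\to V_\varepsilon(x)$ in $[-\infty,\infty]$. 2. Let $u\in \mathrm{AC}([a,b];(X,\mathsf d_\phi))$, other than a constant curve at a point where $V_\varepsilon=\infty$. Then $V_\varepsilon\circ u$ is finite and absolutely continuous on $[a,b]$, and $\left|\frac{d}{dt}V_\varepsilon(u(t))\right|\le G_\varepsilon(u(t))\,|u'|(t)$ for a.e. $t\in(a,b)$, where $|u'|$ is the metric derivative with respect to $\mathsf d$. 3. $G_\varepsilon$ is a strong upper gradient of $V_\varepsilon$ with respect to $\mathsf d_\phi$: for every interval $I$ and every $u\in\mathrm{AC}(I;(X,\mathsf d_\phi))$, the function $G_\varepsilon\circ u$ is Borel and $|V_\varepsilon(u(t))-V_\varepsilon(u(s))|\le\int_s^tG_\varepsilon(u(r))\,|u'|_{\mathsf d_\phi}(r)\,dr$ for all $s\le t$ in $I$ (reading $\infty-\infty$ as $0$ when both values are $\infty$). -/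

import Mathlib

open Set Filter Topology MeasureTheory
open scoped ENNReal

namespace WED

noncomputable section

/-! ### Curves in a set with an extended distance

A curve on an interval `I` is represented by a total function `ℝ → X`; only its values on `I`
matter. The distance is a parameter `δ : X → X → ℝ≥0∞`, so that the same notions apply to the
distance `edist` of the space and to an extended Finsler distance. -/

/-- `u ∈ AC^p(I; (X, δ))`: there is `m ∈ L^p(I)` such that `δ (u s) (u t) ≤ ∫_s^t m` for all
`s ≤ t` in `I`. -/
def ACCurve {X : Type*} (δ : X → X → ℝ≥0∞) (p : ℝ≥0∞) (I : Set ℝ) (u : ℝ → X) : Prop :=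
  ∃ m : ℝ → ℝ, MemLp m p (volume.restrict I) ∧
    ∀ s ∈ I, ∀ t ∈ I, s ≤ t → δ (u s) (u t) ≤ ENNReal.ofReal (∫ r in s..t, m r)

/-- `u ∈ AC^p_loc(I; (X, δ))`: `u ∈ AC^p(J; (X, δ))` for every compact interval `J ⊆ I`. -/
def ACCurveLoc {X : Type*} (δ : X → X → ℝ≥0∞) (p : ℝ≥0∞) (I : Set ℝ) (u : ℝ → X) : Prop :=
  ∀ a b : ℝ, Icc a b ⊆ I → ACCurve δ p (Icc a b) u

/-- The metric derivative `|u'|(t) = lim_{s → t} δ(u(s), u(t)) / |s - t|`, written as an upper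
limit so that it is defined at every `t`. It is the limit wherever that exists, which for an
absolutely continuous curve is the case at almost every `t`. -/
def metricDeriv {X : Type*} (δ : X → X → ℝ≥0∞) (u : ℝ → X) (t : ℝ) : ℝ≥0∞ :=
  limsup (fun s => δ (u s) (u t) / ENNReal.ofReal |s - t|) (𝓝[≠] t)

/-- `g` is a (strong) upper gradient of `ψ : X → (-∞, ∞]` with respect to `δ`: for every interval
`I` and every `u ∈ AC(I; (X, δ))` the function `g ∘ u` is Borel on `I`, and
`|ψ(u(t)) - ψ(u(s))| ≤ ∫_s^t g(u(r)) |u'|(r) dr` for all `s ≤ t` in `I`. The last inequality is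
written as two inequalities without subtraction; where both values of `ψ` are `∞`, their
difference is thus read as `0`. -/
def IsStrongUpperGradient {X : Type*} (δ : X → X → ℝ≥0∞) (ψ : X → EReal) (g : X → ℝ≥0∞) : Prop :=
  ∀ (I : Set ℝ), I.OrdConnected → ∀ u : ℝ → X, ACCurve δ 1 I u →
    Measurable (fun t : I => g (u t)) ∧
    ∀ s ∈ I, ∀ t ∈ I, s ≤ t →
      ψ (u t) ≤ ψ (u s) + ((∫⁻ r in Icc s t, g (u r) * metricDeriv δ u r : ℝ≥0∞) : EReal) ∧
      ψ (u s) ≤ ψ (u t) + ((∫⁻ r in Icc s t, g (u r) * metricDeriv δ u r : ℝ≥0∞) : EReal)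

/-! ### The metric-topological setting and the assumptions on the energy -/

/-- `(X, d, σ)` is a compatible metric-topological space: `σ` is Hausdorff, the distance is
sequentially `σ`-lower semicontinuous, and every `σ`-open `U ∋ x` contains a uniform metric
neighbourhood of some `σ`-open `V ∋ x`. -/
structure CompatibleTopology {X : Type*} [MetricSpace X] (σ : TopologicalSpace X) : Prop where
  hausdorff : @T2Space X σ
  dist_lsc : ∀ (u v : ℕ → X) (x y : X), Tendsto u atTop (@nhds X σ x) →
    Tendsto v atTop (@nhds X σ y) → edist x y ≤ liminf (fun n => edist (u n) (v n)) atTop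
  nhds_compat : ∀ (U : Set X) (x : X), IsOpen[σ] U → x ∈ U →
    ∃ V : Set X, IsOpen[σ] V ∧ x ∈ V ∧ ∃ δ : ℝ, 0 < δ ∧ ∀ y : X, Metric.infDist y V < δ → y ∈ U

/-- The standard lower semicontinuity-coercivity-compactness assumptions on a proper functional
`φ : X → (-∞, ∞]`, with coercivity constants `A, B` and base point `ustar`. -/
structure LSCC {X : Type*} [MetricSpace X] (σ : TopologicalSpace X) (φ : X → EReal)
    (ustar : X) (A B : ℝ) : Prop where
  ne_bot : ∀ x, φ x ≠ ⊥
  proper : ∃ x, φ x ≠ ⊤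
  lsc : ∀ (u : ℕ → X) (x : X), Bornology.IsBounded (range u) →
    Tendsto u atTop (@nhds X σ x) → φ x ≤ liminf (fun n => φ (u n)) atTop
  compact : ∀ u : ℕ → X, (∃ c : ℝ, ∀ n, φ (u n) ≤ (c : EReal)) →
    Bornology.IsBounded (range u) →
    ∃ (k : ℕ → ℕ) (x : X), StrictMono k ∧ Tendsto (u ∘ k) atTop (@nhds X σ x)
  A_nonneg : 0 ≤ A
  B_nonneg : 0 ≤ B
  coercive : ∀ u v : X,
    ((-(B * dist u v ^ 2) - (B * dist v ustar ^ 2 + A) : ℝ) : EReal) ≤ φ u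

/-! ### The WED functional and its value function -/

/-- The probability measure `μ_ε = ε⁻¹ e^{-t/ε} dt` on `(0, ∞)`. -/
def expMeasure (ε : ℝ) : Measure ℝ :=
  (volume.restrict (Ioi 0)).withDensity (fun t => ENNReal.ofReal (Real.exp (-t / ε) / ε))

/-- The integral `∫ f⁺ dμ - ∫ f⁻ dμ` of an extended-real function (meaningful unless both terms
are infinite). -/
def extIntegral (μ : Measure ℝ) (f : ℝ → EReal) : EReal :=
  ((∫⁻ t, (f t).toENNReal ∂μ : ℝ≥0∞) : EReal) - ((∫⁻ t, (-f t).toENNReal ∂μ : ℝ≥0∞) : EReal)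

/-- `ℓ_ε(x, v) = (ε/2) v² + φ(x)`. -/
def lagrangian {X : Type*} (φ : X → EReal) (ε : ℝ) (x : X) (v : ℝ≥0∞) : EReal :=
  ((ENNReal.ofReal (ε / 2) * v ^ 2 : ℝ≥0∞) : EReal) + φ x

/-- The weighted energy-dissipation functional `I_ε[u] = ∫_0^∞ ℓ_ε(u, |u'|) dμ_ε`. -/
def wedFunctional {X : Type*} [MetricSpace X] (φ : X → EReal) (ε : ℝ) (u : ℝ → X) : EReal :=
  extIntegral (expMeasure ε) (fun t => lagrangian φ ε (u t) (metricDeriv edist u t))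

/-- The admissible trajectories: `u ∈ AC²_loc([0, ∞); X)`, `u(0) = x`, `∫_0^∞ |u'|² dμ_ε < ∞`. -/
def admissible {X : Type*} [MetricSpace X] (ε : ℝ) (x : X) : Set (ℝ → X) :=
  {u | ACCurveLoc edist 2 (Ici 0) u ∧ u 0 = x ∧
    ∫⁻ t, metricDeriv edist u t ^ 2 ∂(expMeasure ε) < ⊤}

/-- The value function `V_ε(x) = inf I_ε[u]` over the admissible trajectories from `x`. -/
def valueFunction {X : Type*} [MetricSpace X] (φ : X → EReal) (ε : ℝ) (x : X) : EReal :=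
  ⨅ u ∈ admissible ε x, wedFunctional φ ε u

open Classical in
/-- `G_ε(x) = √(2 (φ(x) - V_ε(x)) / ε)` if `V_ε(x) < ∞`, and `G_ε(x) = ∞` otherwise. -/
def upperSlope {X : Type*} [MetricSpace X] (φ : X → EReal) (ε : ℝ) (x : X) : ℝ≥0∞ :=
  if valueFunction φ ε x = ⊤ then ⊤
  else (ENNReal.ofReal (2 / ε) * (φ x - valueFunction φ ε x).toENNReal) ^ (1 / 2 : ℝ)

/-! ### The Finsler distance -/

/-- The Finsler extended distance induced by `f : X → [1, ∞]`: the infimum of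
`∫_a^b f(θ(t)) |θ'|(t) dt` over the absolutely continuous curves `θ : [a, b] → X` from `x` to `y`
(so `∞` if there are none), with the usual convention `∞ * 0 = 0`. -/
def finslerDist {X : Type*} [MetricSpace X] (f : X → ℝ≥0∞) (x y : X) : ℝ≥0∞ :=
  ⨅ (a : ℝ) (b : ℝ) (θ : ℝ → X)
    (_ : a ≤ b ∧ ACCurve edist 1 (Icc a b) θ ∧ θ a = x ∧ θ b = y),
    ∫⁻ t in Icc a b, f (θ t) * metricDeriv edist θ t

/-- The distance `d_φ`, induced by `f = (φ ∨ 1)^{1/2}`. -/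
def energyDist {X : Type*} [MetricSpace X] (φ : X → EReal) : X → X → ℝ≥0∞ :=
  finslerDist (fun x => (max (φ x) 1).toENNReal ^ (1 / 2 : ℝ))

end

end WED

/-! The core is a dynamic programming inequality. The measure `μ_ε` is memoryless, so following a
curve `w` with speed at most `m` up to time `T`, and then an almost optimal trajectory from `w T`,
gives `V (w 0) ≤ ∫_0^T (m²/2 + φ(w)/ε) e^{-r/ε} dr + e^{-T/ε} V (w T)`. A Poincaré inequality for
`μ_ε` with constant `4ε²` lets the kinetic term absorb the quadratic negative part of `φ`. Hence no
cost has the form `∞ - ∞`, and `V x ≥ -B d²(x, u_*) - A`.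

Running `w` faster by a factor `l` and differentiating gives `-(V ∘ w)' ≤ l m²/2 + (φ - V)/(l ε)`
for every `l > 0`. The right-hand side has infimum `m G(w)`. Since `d` is symmetric, the reversed
curve bounds the opposite increment, and so `|V(w a) - V(w b)| ≤ ∫ G(w) m`.

This requires `m ∈ L²` and `φ ∘ w` integrable. A curve `θ` of finite weighted length `∫ (φ ∨
1)^{1/2} |θ'|` acquires both when it is run at speed at most `(φ ∨ 1)^{1/2}`: the integral of `φ ∨
1` in the new time is then bounded by the weighted length (`exists_reparametrization`,
`energyCurve_of_weight`). The bound `∫ G(θ) |θ'|` survives the change of time, which gives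
`valueFunction_increment_le`. Coinciding end points are a separate alternative there, because `V`
may be infinite on a constant curve.

Two facts link this to `d_φ`. The weight is lower semicontinuous, so `d_φ ≥ c d` at small scale for
each `c` below the weight; thus a `d_φ`-absolutely continuous curve satisfies weight `· |u'| ≤ m`
a.e. and has finite weighted length. And `G ≤ K ·` weight wherever `V` is bounded below. Together
these yield local Lipschitz continuity of `V` for `d_φ` and absolute continuity of `V ∘ u`. Lebesgue
differentiation of the increment bound gives the pointwise estimate, and `d ≤ d_φ` gives the upper
gradient property. -/

namespace WED

/-! ### Absolutely continuous functions and the metric derivative -/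

/-- A function whose increments are dominated by the integrals of an integrable function is
absolutely continuous. -/
theorem absolutelyContinuousOnInterval_of_abs_sub_le {F g : ℝ → ℝ} {a b : ℝ} (hab : a ≤ b)
    (hg : IntervalIntegrable g volume a b)
    (h : ∀ s ∈ Icc a b, ∀ t ∈ Icc a b, s ≤ t → |F t - F s| ≤ ∫ r in s..t, g r) :
    AbsolutelyContinuousOnInterval F a b := by
  have hAC := hg.absolutelyContinuousOnInterval_intervalIntegral (left_mem_uIcc (a := a) (b := b))
  rw [absolutelyContinuousOnInterval_iff] at hAC ⊢
  have key : ∀ s ∈ Icc a b, ∀ t ∈ Icc a b,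
      dist (F s) (F t) ≤ dist (∫ r in a..s, g r) (∫ r in a..t, g r) := by
    have hi : ∀ s ∈ Icc a b, IntervalIntegrable g volume a s := fun s hs =>
      hg.mono_set (by rw [uIcc_of_le hs.1, uIcc_of_le hab]; exact Icc_subset_Icc le_rfl hs.2)
    have key' : ∀ s ∈ Icc a b, ∀ t ∈ Icc a b, s ≤ t →
        dist (F s) (F t) ≤ dist (∫ r in a..s, g r) (∫ r in a..t, g r) := by
      intro s hs t ht hst
      rw [Real.dist_eq, Real.dist_eq, abs_sub_comm, abs_sub_comm (∫ r in a..s, g r),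
        intervalIntegral.integral_interval_sub_left (hi t ht) (hi s hs)]
      exact (h s hs t ht hst).trans (le_abs_self _)
    intro s hs t ht
    rcases le_total s t with hst | hst
    · exact key' s hs t ht hst
    · rw [dist_comm, dist_comm (∫ r in a..s, g r)]
      exact key' t ht s hs hst
  intro e he
  obtain ⟨d, hd, hE⟩ := hAC e he
  refine ⟨d, hd, fun E hE1 hE2 => (Finset.sum_le_sum fun i hi => ?_).trans_lt (hE E hE1 hE2)⟩
  have := hE1.1 i hi
  rw [uIcc_of_le hab] at this
  exact key _ this.1 _ this.2

theorem metricDeriv_congr {X : Type*} {δ : X → X → ℝ≥0∞} {u v : ℝ → X} {t : ℝ}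
    (h : u =ᶠ[𝓝 t] v) : metricDeriv δ u t = metricDeriv δ v t := by
  refine limsup_congr ?_
  filter_upwards [h.filter_mono nhdsWithin_le_nhds] with s hs
  rw [hs, h.eq_of_nhds]

theorem metricDeriv_comp_add {X : Type*} (δ : X → X → ℝ≥0∞) (u : ℝ → X) (c t : ℝ) :
    metricDeriv δ (fun r => u (r + c)) t = metricDeriv δ u (t + c) := by
  have hm : map (fun s : ℝ => s + c) (𝓝[≠] t) = 𝓝[≠] (t + c) := by simp
  unfold metricDeriv
  rw [← hm]
  simp only [limsup, limsSup, eventually_map]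
  simp

theorem metricDeriv_mono {X : Type*} {δ δ' : X → X → ℝ≥0∞} (h : ∀ x y, δ x y ≤ δ' x y)
    (u : ℝ → X) (t : ℝ) : metricDeriv δ u t ≤ metricDeriv δ' u t :=
  limsup_le_limsup (Eventually.of_forall fun s => ENNReal.div_le_div_right (h _ _) _)

/-- The common tool for bounding metric derivatives from above: the difference quotients of the
majorant `F` converge, so its derivative controls an upper limit whose own convergence is unknown.
-/
theorem limsup_div_abs_le {F : ℝ → ℝ} {F' t : ℝ} (hF : HasDerivAt F F' t) {q : ℝ → ℝ≥0∞}
    (hq : ∀ᶠ s in 𝓝[≠] t, q s ≤ ENNReal.ofReal |F s - F t|) :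
    limsup (fun s => q s / ENNReal.ofReal |s - t|) (𝓝[≠] t) ≤ ENNReal.ofReal |F'| := by
  have h1 : Tendsto (fun s => ENNReal.ofReal |slope F t s|) (𝓝[≠] t) (𝓝 (ENNReal.ofReal |F'|)) :=
    ENNReal.tendsto_ofReal (hasDerivAt_iff_tendsto_slope.1 hF).abs
  rw [← h1.limsup_eq]
  refine limsup_le_limsup ?_
  filter_upwards [hq, self_mem_nhdsWithin] with s hs hst
  have hpos : 0 < |s - t| := abs_pos.2 (sub_ne_zero.2 hst)
  rw [slope_def_field, abs_div, ENNReal.ofReal_div_of_pos hpos]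
  exact ENNReal.div_le_div_right hs _

/-- The metric derivative of a continuous curve is Borel. -/
theorem measurable_metricDeriv {X : Type*} [MetricSpace X] {u : ℝ → X} (hu : Continuous u) :
    Measurable (metricDeriv edist u) := by
  have h1 : metricDeriv edist u = fun t => ⨅ n : ℕ, ⨆ h ∈ {h : ℝ | h ≠ 0 ∧ |h| < 1 / (n + 1)},
      edist (u (t + h)) (u t) / ENNReal.ofReal |h| := by
    ext t
    have hb : (𝓝[≠] t).HasBasis (fun _ : ℕ => True)
        (fun n => {s : ℝ | s ≠ t ∧ |s - t| < 1 / (n + 1)}) := by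
      have := nhdsWithin_hasBasis (Metric.nhds_basis_ball_inv_nat_succ (x := t)) {t}ᶜ
      refine this.to_hasBasis (fun n _ => ⟨n, trivial, ?_⟩) (fun n _ => ⟨n, trivial, ?_⟩)
      · rintro s ⟨h1, h2⟩
        exact ⟨by simpa [Real.dist_eq] using h2, h1⟩
      · rintro s ⟨h1, h2⟩
        exact ⟨h2, by simpa [Real.dist_eq] using h1⟩
    unfold metricDeriv
    rw [hb.limsup_eq_iInf_iSup]
    simp only [iInf_true]
    refine iInf_congr fun n => le_antisymm (iSup₂_le fun s hs => ?_) (iSup₂_le fun h hh => ?_)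
    · refine le_trans (le_of_eq ?_) (le_iSup₂ (s - t) ⟨sub_ne_zero.2 hs.1, hs.2⟩)
      simp
    · refine le_trans (le_of_eq ?_) (le_iSup₂ (t + h) ⟨by simpa using hh.1, by simpa using hh.2⟩)
      simp
  rw [h1]
  -- The supremum over `h` is uncountable, but it is lower semicontinuous in `t` and hence Borel;
  -- only the infimum over `n` has to be countable.
  refine Measurable.iInf fun n => LowerSemicontinuous.measurable ?_
  refine lowerSemicontinuous_iSup fun h => lowerSemicontinuous_iSup fun hh => ?_
  refine Continuous.lowerSemicontinuous ?_
  have h0 : ENNReal.ofReal |h| ≠ 0 := by simpa using hh.1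
  refine ENNReal.continuous_div_const _ h0 |>.comp ?_
  fun_prop

/-- Lebesgue differentiation of `∫ m`. Symmetry of `δ` enters because the upper limit is two-sided
while the bound is given only for ordered times. -/
theorem ae_metricDeriv_le {X : Type*} {δ : X → X → ℝ≥0∞} (hδ : ∀ x y, δ x y = δ y x)
    {u : ℝ → X} {m : ℝ → ℝ} {a b : ℝ} (hab : a ≤ b) (hm : IntervalIntegrable m volume a b)
    (h : ∀ s ∈ Icc a b, ∀ t ∈ Icc a b, s ≤ t →
      δ (u s) (u t) ≤ ENNReal.ofReal (∫ r in s..t, m r)) :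
    ∀ᵐ t ∂(volume.restrict (Icc a b)), metricDeriv δ u t ≤ ENNReal.ofReal |m t| := by
  rw [← restrict_Ioo_eq_restrict_Icc, ae_restrict_iff' measurableSet_Ioo]
  filter_upwards [hm.ae_hasDerivAt_integral] with t ht hts
  have hts' := Ioo_subset_Icc_self hts
  rw [uIcc_of_le hab] at ht
  have hd := ht hts' a (left_mem_Icc.2 hab)
  refine limsup_div_abs_le hd ?_
  have hi : ∀ s ∈ Icc a b, IntervalIntegrable m volume a s := fun s hs =>
    hm.mono_set (by rw [uIcc_of_le hs.1, uIcc_of_le hab]; exact Icc_subset_Icc le_rfl hs.2)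
  filter_upwards [nhdsWithin_le_nhds (Icc_mem_nhds hts.1 hts.2)] with s hs
  rw [intervalIntegral.integral_interval_sub_left (hi s hs) (hi t hts')]
  rcases le_total s t with hst | hst
  · rw [intervalIntegral.integral_symm, abs_neg]
    exact (h s hs t hts' hst).trans (ENNReal.ofReal_le_ofReal (le_abs_self _))
  · rw [hδ]
    exact (h t hts' s hs hst).trans (ENNReal.ofReal_le_ofReal (le_abs_self _))

theorem ofReal_abs_deriv_le_metricDeriv {X : Type*} [MetricSpace X] {u : ℝ → X} {h : ℝ → ℝ}
    {t : ℝ} (hd : DifferentiableAt ℝ h t)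
    (hh : ∀ᶠ s in 𝓝[≠] t, |h s - h t| ≤ dist (u s) (u t)) :
    ENNReal.ofReal |deriv h t| ≤ metricDeriv edist u t := by
  have h1 : Tendsto (fun s => ENNReal.ofReal |slope h t s|) (𝓝[≠] t)
      (𝓝 (ENNReal.ofReal |deriv h t|)) :=
    ENNReal.tendsto_ofReal (hasDerivAt_iff_tendsto_slope.1 hd.hasDerivAt).abs
  rw [← h1.limsup_eq]
  refine limsup_le_limsup ?_
  filter_upwards [hh, self_mem_nhdsWithin] with s hs hst
  have hpos : 0 < |s - t| := abs_pos.2 (sub_ne_zero.2 hst)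
  rw [slope_def_field, abs_div, ENNReal.ofReal_div_of_pos hpos]
  refine ENNReal.div_le_div_right ?_ _
  rw [edist_dist]
  exact ENNReal.ofReal_le_ofReal hs

theorem ofReal_abs_sub_le_lintegral_deriv {F : ℝ → ℝ} {a b : ℝ} (hab : a ≤ b)
    (hF : AbsolutelyContinuousOnInterval F a b) :
    ENNReal.ofReal |F b - F a| ≤ ∫⁻ t in Icc a b, ENNReal.ofReal |deriv F t| := by
  rw [← hF.integral_deriv_eq_sub, intervalIntegral.integral_of_le hab,
    ← restrict_Ioc_eq_restrict_Icc, ← Real.enorm_eq_ofReal_abs]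
  refine (enorm_integral_le_lintegral_enorm _).trans (le_of_eq ?_)
  simp only [Real.enorm_eq_ofReal_abs]

theorem ACCurve.intervalIntegrable {m : ℝ → ℝ} {p : ℝ≥0∞} (hp : 1 ≤ p) {I : Set ℝ} {a b : ℝ}
    (hI : Icc a b ⊆ I) (hab : a ≤ b) (hm : MemLp m p (volume.restrict I)) :
    IntervalIntegrable m volume a b := by
  rw [intervalIntegrable_iff_integrableOn_Icc_of_le hab]
  exact (hm.mono_measure (Measure.restrict_mono hI le_rfl)).integrable hp

/-- The length of an absolutely continuous curve dominates the distance of its end points. -/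
theorem edist_le_lintegral_metricDeriv {X : Type*} [MetricSpace X] {u : ℝ → X} {a b : ℝ}
    (hab : a ≤ b) (hu : ACCurve edist 1 (Icc a b) u) :
    edist (u a) (u b) ≤ ∫⁻ t in Icc a b, metricDeriv edist u t := by
  obtain ⟨m, hm, h⟩ := hu
  have hmi := ACCurve.intervalIntegrable le_rfl subset_rfl hab hm
  have hdist : ∀ s ∈ Icc a b, ∀ t ∈ Icc a b, s ≤ t → dist (u s) (u t) ≤ ∫ r in s..t, |m r| := by
    intro s hs t ht hst
    have h1 := h s hs t ht hst
    have h2 : ∫ r in s..t, m r ≤ ∫ r in s..t, |m r| :=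
      (le_abs_self _).trans (intervalIntegral.abs_integral_le_integral_abs hst)
    rw [edist_dist] at h1
    exact (ENNReal.ofReal_le_ofReal_iff (intervalIntegral.integral_nonneg hst
      fun _ _ => abs_nonneg _)).1 (h1.trans (ENNReal.ofReal_le_ofReal h2))
  have hlip : ∀ s t, |dist (u t) (u a) - dist (u s) (u a)| ≤ dist (u t) (u s) := fun s t =>
    abs_dist_sub_le _ _ _
  -- The problem reduces to a real function: the distance to the starting point is absolutely
  -- continuous, and its derivative is at most the metric derivative because `dist` is 1-Lipschitz.
  have hAC : AbsolutelyContinuousOnInterval (fun t => dist (u t) (u a)) a b :=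
    absolutelyContinuousOnInterval_of_abs_sub_le hab hmi.abs fun s hs t ht hst =>
      (hlip s t).trans (by rw [dist_comm]; exact hdist s hs t ht hst)
  have h1 := ofReal_abs_sub_le_lintegral_deriv hab hAC
  simp only [dist_self, sub_zero, abs_dist] at h1
  rw [edist_comm, edist_dist]
  refine h1.trans (lintegral_mono_ae ?_)
  rw [ae_restrict_iff' measurableSet_Icc]
  filter_upwards [hAC.ae_differentiableAt] with t ht hts
  rw [uIcc_of_le hab] at ht
  exact ofReal_abs_deriv_le_metricDeriv (ht hts) (Eventually.of_forall fun s => hlip t s)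

theorem ACCurve.mono {X : Type*} {δ : X → X → ℝ≥0∞} {p : ℝ≥0∞} {I J : Set ℝ} {u : ℝ → X}
    (h : ACCurve δ p I u) (hJ : J ⊆ I) : ACCurve δ p J u := by
  obtain ⟨m, hm, h⟩ := h
  exact ⟨m, hm.mono_measure (Measure.restrict_mono hJ le_rfl),
    fun s hs t ht => h s (hJ hs) t (hJ ht)⟩

theorem ACCurve.mono_exponent {X : Type*} {δ : X → X → ℝ≥0∞} {a b : ℝ} {u : ℝ → X}
    (h : ACCurve δ 2 (Icc a b) u) : ACCurve δ 1 (Icc a b) u := by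
  obtain ⟨m, hm, h⟩ := h
  exact ⟨m, hm.mono_exponent one_le_two, h⟩

theorem ACCurve.mono_dist {X : Type*} {δ δ' : X → X → ℝ≥0∞} (h : ∀ x y, δ x y ≤ δ' x y)
    {p : ℝ≥0∞} {I : Set ℝ} {u : ℝ → X} (hu : ACCurve δ' p I u) : ACCurve δ p I u := by
  obtain ⟨m, hm, h'⟩ := hu
  exact ⟨m, hm, fun s hs t ht hst => (h _ _).trans (h' s hs t ht hst)⟩

theorem ACCurve.continuousOn {X : Type*} [MetricSpace X] {u : ℝ → X} {a b : ℝ}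
    (hu : ACCurve edist 1 (Icc a b) u) : ContinuousOn u (Icc a b) := by
  rcases lt_or_ge b a with hab | hab
  · simp [Icc_eq_empty_of_lt hab]
  obtain ⟨m, hm, h⟩ := hu
  have hmi := ACCurve.intervalIntegrable le_rfl subset_rfl hab hm
  have hi : ∀ s ∈ Icc a b, IntervalIntegrable m volume a s := fun s hs =>
    hmi.mono_set (by rw [uIcc_of_le hs.1, uIcc_of_le hab]; exact Icc_subset_Icc le_rfl hs.2)
  have hc : ContinuousOn (fun x => ∫ r in a..x, m r) (Icc a b) := by
    have := intervalIntegral.continuousOn_primitive_interval' hmi (left_mem_uIcc)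
    rwa [uIcc_of_le hab] at this
  intro t ht
  rw [ContinuousWithinAt, tendsto_iff_edist_tendsto_0]
  have h0 : Tendsto (fun s => ENNReal.ofReal |(∫ r in a..s, m r) - ∫ r in a..t, m r|)
      (𝓝[Icc a b] t) (𝓝 0) := by
    have := ((hc t ht).sub_const (∫ r in a..t, m r)).abs
    simpa using ENNReal.tendsto_ofReal this
  refine tendsto_of_tendsto_of_tendsto_of_le_of_le' tendsto_const_nhds h0
    (Eventually.of_forall fun _ => zero_le) ?_
  filter_upwards [self_mem_nhdsWithin] with s hs
  rw [intervalIntegral.integral_interval_sub_left (hi s hs) (hi t ht)]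
  rcases le_total s t with hst | hst
  · rw [intervalIntegral.integral_symm, abs_neg]
    exact (h s hs t ht hst).trans (ENNReal.ofReal_le_ofReal (le_abs_self _))
  · rw [edist_comm]
    exact (h t ht s hs hst).trans (ENNReal.ofReal_le_ofReal (le_abs_self _))

/-- Restriction of a curve to `[a, b]`, extended by constants. -/
def clamp {X : Type*} (a b : ℝ) (u : ℝ → X) (t : ℝ) : X := u (max a (min b t))

theorem clamp_of_mem {X : Type*} {a b t : ℝ} (u : ℝ → X) (ht : t ∈ Icc a b) :
    clamp a b u t = u t := by
  simp [clamp, ht.1, ht.2]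

theorem continuous_clamp {X : Type*} [TopologicalSpace X] {a b : ℝ} (hab : a ≤ b) {u : ℝ → X}
    (hu : ContinuousOn u (Icc a b)) : Continuous (clamp a b u) :=
  hu.comp_continuous (by fun_prop) fun t => ⟨le_max_left _ _, max_le hab (min_le_left _ _)⟩

theorem metricDeriv_clamp {X : Type*} {δ : X → X → ℝ≥0∞} {a b t : ℝ} (u : ℝ → X)
    (ht : t ∈ Ioo a b) : metricDeriv δ (clamp a b u) t = metricDeriv δ u t :=
  metricDeriv_congr (by
    filter_upwards [Icc_mem_nhds ht.1 ht.2] with s hs using clamp_of_mem u hs)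

theorem aemeasurable_metricDeriv_Icc {X : Type*} [MetricSpace X] {u : ℝ → X} {a b : ℝ}
    (hu : ContinuousOn u (Icc a b)) :
    AEMeasurable (metricDeriv edist u) (volume.restrict (Icc a b)) := by
  rcases lt_or_ge b a with hab | hab
  · simp [Icc_eq_empty_of_lt hab]
  rw [← restrict_Ioo_eq_restrict_Icc]
  refine (measurable_metricDeriv (continuous_clamp hab hu)).aemeasurable.congr ?_
  rw [EventuallyEq, ae_restrict_iff' measurableSet_Ioo]
  exact Eventually.of_forall fun t ht => metricDeriv_clamp u ht

end WED

namespace WED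

/-! ### Lower semicontinuity of the energy -/

theorem lowerSemicontinuous_of_seq {X : Type*} [MetricSpace X] {φ : X → EReal}
    (h : ∀ (u : ℕ → X) (x : X), Tendsto u atTop (𝓝 x) → φ x ≤ liminf (fun n => φ (u n)) atTop) :
    LowerSemicontinuous φ := by
  intro x c hc
  by_contra hcon
  obtain ⟨y, hy, hyc⟩ := exists_seq_forall_of_frequently (not_eventually.1 hcon)
  refine absurd (hc.trans_le (h y x hy)) (not_lt.2 ?_)
  refine (liminf_le_liminf (v := fun _ => c) (Eventually.of_forall fun n => ?_)).trans ?_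
  · exact not_lt.1 (hyc n)
  · simp

/-- The compatibility condition says that `σ` is coarser than the metric topology along sequences.
This transfers the `σ`-lower semicontinuity of `φ` to `d`. -/
theorem CompatibleTopology.tendsto {X : Type*} [MetricSpace X] {u : ℕ → X} {x : X}
    (h : Tendsto u atTop (𝓝 x)) {σ : TopologicalSpace X} (hσ : CompatibleTopology σ) :
    Tendsto u atTop (@nhds X σ x) := by
  intro U hU
  obtain ⟨W, hWU, hW, hxW⟩ := mem_nhds_iff.1 hU
  obtain ⟨V, -, hxV, δ, hδ, hy⟩ := hσ.nhds_compat W x hW hxW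
  rw [mem_map]
  filter_upwards [(Metric.tendsto_nhds.1 h) δ hδ] with n hn
  exact hWU (hy _ ((Metric.infDist_le_dist_of_mem hxV).trans_lt hn))

/-! ### The exponential measure -/

theorem lintegral_expMeasure (ε : ℝ) (F : ℝ → ℝ≥0∞) :
    ∫⁻ t, F t ∂(expMeasure ε) =
      ∫⁻ t in Ioi 0, ENNReal.ofReal (Real.exp (-t / ε) / ε) * F t := by
  unfold expMeasure
  rw [lintegral_withDensity_eq_lintegral_mul_non_measurable _ (by fun_prop)
    (Eventually.of_forall fun _ => ENNReal.ofReal_lt_top)]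
  rfl

theorem lintegral_exp_Ioi {κ : ℝ} (hκ : 0 < κ) (c : ℝ) :
    ∫⁻ t in Ioi c, ENNReal.ofReal (Real.exp (-t / κ)) = ENNReal.ofReal (κ * Real.exp (-c / κ)) := by
  have hneg : -κ⁻¹ < 0 := by simpa using hκ
  have h1 : ∀ t : ℝ, Real.exp (-t / κ) = Real.exp (-κ⁻¹ * t) := fun t => by
    congr 1; field_simp
  simp only [h1]
  rw [← ofReal_integral_eq_lintegral_ofReal (integrableOn_exp_mul_Ioi hneg c)
    (Eventually.of_forall fun _ => (Real.exp_pos _).le), integral_exp_mul_Ioi hneg c]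
  congr 1
  field_simp

theorem isProbabilityMeasure_expMeasure {ε : ℝ} (hε : 0 < ε) :
    IsProbabilityMeasure (expMeasure ε) := by
  constructor
  have h := lintegral_expMeasure ε (fun _ => 1)
  rw [lintegral_one] at h
  rw [h]
  have h1 : ∀ t : ℝ, ENNReal.ofReal (Real.exp (-t / ε) / ε) * 1 =
      ENNReal.ofReal (Real.exp (-t / ε)) * ENNReal.ofReal ε⁻¹ := fun t => by
    rw [mul_one, div_eq_mul_inv, ENNReal.ofReal_mul (Real.exp_pos _).le]
  simp only [h1]
  rw [lintegral_mul_const' _ _ ENNReal.ofReal_ne_top, lintegral_exp_Ioi hε,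
    ← ENNReal.ofReal_mul (by positivity)]
  simp [hε.ne']

theorem setLIntegral_expMeasure {ε : ℝ} {S : Set ℝ} (hS : MeasurableSet S) (F : ℝ → ℝ≥0∞) :
    ∫⁻ t in S, F t ∂(expMeasure ε) =
      ∫⁻ t in S ∩ Ioi 0, ENNReal.ofReal (Real.exp (-t / ε) / ε) * F t := by
  rw [← lintegral_indicator hS, lintegral_expMeasure, ← Measure.restrict_restrict hS,
    ← lintegral_indicator hS]
  refine lintegral_congr fun t => ?_
  by_cases ht : t ∈ S <;> simp [ht]

/-- The exponential measure is memoryless. -/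
theorem setLIntegral_expMeasure_Ioi {ε T : ℝ} (hT : 0 ≤ T) (F : ℝ → ℝ≥0∞) :
    ∫⁻ t in Ioi T, F t ∂(expMeasure ε) =
      ENNReal.ofReal (Real.exp (-T / ε)) * ∫⁻ t, F (t + T) ∂(expMeasure ε) := by
  rw [setLIntegral_expMeasure measurableSet_Ioi, lintegral_expMeasure,
    inter_eq_left.2 (Ioi_subset_Ioi hT), ← lintegral_indicator measurableSet_Ioi,
    ← lintegral_add_right_eq_self _ T, ← lintegral_const_mul' _ _ ENNReal.ofReal_ne_top,
    ← lintegral_indicator measurableSet_Ioi]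
  refine lintegral_congr fun t => ?_
  by_cases ht : 0 < t
  · rw [indicator_of_mem (by simpa using ht), indicator_of_mem (by simpa using ht), ← mul_assoc,
      ← ENNReal.ofReal_mul (Real.exp_pos _).le, ← mul_div_assoc, ← Real.exp_add]
    congr 4
    ring
  · rw [indicator_of_notMem (by simpa using ht), indicator_of_notMem (by simpa using ht)]

theorem ENNReal.sq_lintegral_mul_le {α : Type*} [MeasurableSpace α] {μ : Measure α}
    {f g : α → ℝ≥0∞} (hf : AEMeasurable f μ) (hg : AEMeasurable g μ) :
    (∫⁻ t, f t * g t ∂μ) ^ 2 ≤ (∫⁻ t, f t ^ 2 ∂μ) * ∫⁻ t, g t ^ 2 ∂μ := by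
  have h := ENNReal.lintegral_mul_le_Lp_mul_Lq μ Real.HolderConjugate.two_two hf hg
  simp only [Pi.mul_apply, ENNReal.rpow_ofNat] at h
  refine (pow_le_pow_left₀ zero_le h 2).trans (le_of_eq ?_)
  rw [mul_pow, ← ENNReal.rpow_natCast, ← ENNReal.rpow_natCast, ← ENNReal.rpow_mul,
    ← ENNReal.rpow_mul]
  norm_num

/-- Poincaré inequality for the exponential measure. -/
theorem lintegral_sq_primitive_expMeasure_le {ε : ℝ} (hε : 0 < ε) {a g : ℝ → ℝ≥0∞}
    (hg : Measurable g) (ha : ∀ t, 0 < t → a t ≤ ∫⁻ r in Icc 0 t, g r) :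
    ∫⁻ t, a t ^ 2 ∂(expMeasure ε) ≤
      ENNReal.ofReal (4 * ε ^ 2) * ∫⁻ t, g t ^ 2 ∂(expMeasure ε) := by
  -- Cauchy-Schwarz with weight `e^{-r/κ}` produces the constant `ε κ² / (κ - ε)`, which is minimal
  -- at `κ = 2ε` with value `4ε²`.
  set κ := 2 * ε with hκ
  have hκ0 : 0 < κ := by positivity
  set k : ℝ → ℝ≥0∞ := fun r => g r ^ 2 * ENNReal.ofReal (Real.exp (-r / κ)) with hk
  have hkm : Measurable k := by fun_prop
  have hexp2 : ∀ r : ℝ, ENNReal.ofReal (Real.exp (r / (2 * κ))) ^ 2 =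
      ENNReal.ofReal (Real.exp (r / κ)) := fun r => by
    rw [← ENNReal.ofReal_pow (Real.exp_pos _).le, ← Real.exp_nat_mul]
    congr 2
    push_cast; field_simp
  have hsq : ∀ t, 0 < t → a t ^ 2 ≤ (∫⁻ r in Icc 0 t, k r) *
      ENNReal.ofReal (κ * Real.exp (t / κ)) := by
    intro t ht
    have h1 : ∀ r, g r = (g r * ENNReal.ofReal (Real.exp (-r / (2 * κ)))) *
        ENNReal.ofReal (Real.exp (r / (2 * κ))) := fun r => by
      rw [mul_assoc, ← ENNReal.ofReal_mul (Real.exp_pos _).le, ← Real.exp_add]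
      simp [neg_div]
    refine (pow_le_pow_left₀ zero_le (ha t ht) 2).trans ?_
    rw [lintegral_congr h1]
    refine (ENNReal.sq_lintegral_mul_le (by fun_prop) (by fun_prop)).trans ?_
    simp only [mul_pow, hexp2]
    refine mul_le_mul' le_rfl ?_
    have hi : IntegrableOn (fun r => Real.exp (r / κ)) (Icc 0 t) :=
      (by fun_prop : Continuous fun r => Real.exp (r / κ)).integrableOn_Icc
    rw [← ofReal_integral_eq_lintegral_ofReal hi
      (Eventually.of_forall fun _ => (Real.exp_pos _).le)]
    refine ENNReal.ofReal_le_ofReal ?_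
    rw [integral_Icc_eq_integral_Ioc, ← intervalIntegral.integral_of_le ht.le,
      intervalIntegral.integral_comp_div _ hκ0.ne', integral_exp]
    simp only [zero_div, Real.exp_zero, smul_eq_mul]
    -- The integral is `κ (e^{t/κ} - 1)`; the `-1` is dropped.
    nlinarith
  calc ∫⁻ t, a t ^ 2 ∂(expMeasure ε)
      = ∫⁻ t in Ioi 0, ENNReal.ofReal (Real.exp (-t / ε) / ε) * a t ^ 2 :=
        lintegral_expMeasure _ _
    _ ≤ ∫⁻ t in Ioi 0, ∫⁻ r in Ioi 0, (Icc 0 t).indicator k r *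
          ENNReal.ofReal (2 * Real.exp (-t / κ)) := by
        refine setLIntegral_mono' measurableSet_Ioi fun t ht => ?_
        refine (mul_le_mul' le_rfl (hsq t ht)).trans (le_of_eq ?_)
        rw [lintegral_mul_const' _ _ ENNReal.ofReal_ne_top, lintegral_indicator measurableSet_Icc,
          Measure.restrict_restrict measurableSet_Icc]
        have hset : Icc 0 t ∩ Ioi 0 = Ioc 0 t := by
          ext r; simp only [mem_inter_iff, mem_Icc, mem_Ioi, mem_Ioc]
          exact ⟨fun h => ⟨h.2, h.1.2⟩, fun h => ⟨⟨h.1.le, h.2⟩, h.1⟩⟩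
        rw [hset, restrict_Ioc_eq_restrict_Icc, mul_left_comm,
          ← ENNReal.ofReal_mul (by positivity)]
        congr 2
        rw [hκ, div_mul_eq_mul_div, mul_left_comm, ← Real.exp_add]
        have : -t / ε + t / (2 * ε) = -t / (2 * ε) := by field_simp; ring
        rw [this]; field_simp
    _ = ∫⁻ r in Ioi 0, ∫⁻ t in Ioi 0, (Icc 0 t).indicator k r *
          ENNReal.ofReal (2 * Real.exp (-t / κ)) := by
        refine lintegral_lintegral_swap (Measurable.aemeasurable ?_)
        have hS : MeasurableSet {z : ℝ × ℝ | 0 ≤ z.2 ∧ z.2 ≤ z.1} :=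
          (measurableSet_le measurable_const measurable_snd).inter
            (measurableSet_le measurable_snd measurable_fst)
        have : (Function.uncurry fun t r => (Icc 0 t).indicator k r *
            ENNReal.ofReal (2 * Real.exp (-t / κ))) = fun z : ℝ × ℝ =>
            {z : ℝ × ℝ | 0 ≤ z.2 ∧ z.2 ≤ z.1}.indicator (fun z => k z.2) z *
              ENNReal.ofReal (2 * Real.exp (-z.1 / κ)) := by
          ext z; simp [Function.uncurry, indicator]
        rw [this]
        exact (((hkm.comp measurable_snd).indicator hS).mul (by fun_prop))
    _ ≤ ∫⁻ r in Ioi 0, ENNReal.ofReal (4 * ε ^ 2) *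
          (ENNReal.ofReal (Real.exp (-r / ε) / ε) * g r ^ 2) := by
        refine setLIntegral_mono' measurableSet_Ioi fun r hr => ?_
        have hr : 0 < r := hr
        have h1 : ∀ t, (Icc 0 t).indicator k r * ENNReal.ofReal (2 * Real.exp (-t / κ)) =
            (Ici r).indicator (fun t => ENNReal.ofReal (Real.exp (-t / κ))) t *
              (k r * ENNReal.ofReal 2) := fun t => by
          by_cases hrt : r ≤ t
          · rw [indicator_of_mem (show r ∈ Icc 0 t from ⟨hr.le, hrt⟩),
              indicator_of_mem (show t ∈ Ici r from hrt), ENNReal.ofReal_mul zero_le_two]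
            ring
          · rw [indicator_of_notMem (fun h => hrt h.2), indicator_of_notMem (s := Ici r) (by simpa using hrt)]
            simp
        simp only [h1]
        rw [lintegral_mul_const _ ((by fun_prop : Measurable fun t : ℝ =>
            ENNReal.ofReal (Real.exp (-t / κ))).indicator measurableSet_Ici),
          lintegral_indicator measurableSet_Ici, Measure.restrict_restrict measurableSet_Ici,
          inter_eq_left.2 (Ici_subset_Ioi.2 hr),
          ← restrict_Ioi_eq_restrict_Ici, lintegral_exp_Ioi hκ0]
        refine le_of_eq ?_
        simp only [hk]
        have h2 : ENNReal.ofReal (κ * Real.exp (-r / κ)) * (ENNReal.ofReal (Real.exp (-r / κ)) *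
            ENNReal.ofReal 2) = ENNReal.ofReal (4 * ε ^ 2) *
              ENNReal.ofReal (Real.exp (-r / ε) / ε) := by
          rw [← ENNReal.ofReal_mul (by positivity), ← ENNReal.ofReal_mul (by positivity),
            ← ENNReal.ofReal_mul (by positivity)]
          congr 1
          rw [show κ * Real.exp (-r / κ) * (Real.exp (-r / κ) * 2) =
            2 * κ * (Real.exp (-r / κ) * Real.exp (-r / κ)) by ring, ← Real.exp_add, hκ]
          have : -r / (2 * ε) + -r / (2 * ε) = -r / ε := by field_simp; ring
          rw [this]; field_simp; ring
        rw [← mul_assoc (ENNReal.ofReal (4 * ε ^ 2)), ← h2]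
        ring
    _ = _ := by
        rw [lintegral_const_mul' _ _ ENNReal.ofReal_ne_top, lintegral_expMeasure]

end WED

namespace WED

/-! ### Bounds for the value function -/

theorem ae_expMeasure_pos (ε : ℝ) : ∀ᵐ t ∂(expMeasure ε), 0 < t :=
  (withDensity_absolutelyContinuous _ _).ae_le (ae_restrict_mem measurableSet_Ioi)

/-- A subtraction-free form of `q - b ≤ (q + φ)⁺ - (q + φ)⁻`, which can be integrated without
knowing that any term is finite. -/
theorem toENNReal_coe_add_add_le {φ : EReal} (hφ : φ ≠ ⊥) {q b : ℝ≥0∞} (hb : -(b : EReal) ≤ φ) :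
    q + (-((q : EReal) + φ)).toENNReal ≤ ((q : EReal) + φ).toENNReal + b := by
  rcases eq_or_ne q ⊤ with rfl | hq
  · simp [EReal.top_add_of_ne_bot hφ]
  rcases eq_or_ne b ⊤ with rfl | hbt
  · simp
  lift q to NNReal using hq
  lift b to NNReal using hbt
  induction φ with
  | bot => exact absurd rfl hφ
  | top => simp
  | coe x =>
    have e1 : (((q : ℝ≥0∞) : EReal) + (x : EReal)) = (((q : ℝ) + x : ℝ) : EReal) := by
      push_cast; rfl
    have hb' : -(b : ℝ) ≤ x := by
      have e2 : ((b : ℝ≥0∞) : EReal) = ((b : ℝ) : EReal) := rfl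
      rwa [e2, ← EReal.coe_neg, EReal.coe_le_coe_iff] at hb
    rw [e1, ← EReal.coe_neg, EReal.real_coe_toENNReal, EReal.real_coe_toENNReal, ← ENNReal.ofReal_coe_nnreal,
      ← ENNReal.ofReal_coe_nnreal]
    rcases le_total 0 ((q : ℝ) + x) with h | h
    · rw [ENNReal.ofReal_of_nonpos (neg_nonpos.2 h), add_zero,
        ← ENNReal.ofReal_add h b.coe_nonneg]
      exact ENNReal.ofReal_le_ofReal (by linarith)
    · rw [ENNReal.ofReal_of_nonpos h, zero_add,
        ← ENNReal.ofReal_add q.coe_nonneg (neg_nonneg.2 h)]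
      exact ENNReal.ofReal_le_ofReal (by linarith)

variable {X : Type*} [MetricSpace X]

/-- The coercivity bound of the energy with constants `A`, `B` and base point `ustar`. -/
structure Coercive (φ : X → EReal) (ustar : X) (A B : ℝ) : Prop where
  ne_bot : ∀ x, φ x ≠ ⊥
  A_nonneg : 0 ≤ A
  B_nonneg : 0 ≤ B
  le : ∀ u v : X, ((-(B * dist u v ^ 2) - (B * dist v ustar ^ 2 + A) : ℝ) : EReal) ≤ φ u

theorem ACCurveLoc.continuous_max_zero {u : ℝ → X} (hu : ACCurveLoc edist 2 (Ici 0) u) :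
    Continuous fun t => u (max 0 t) := by
  refine ContinuousOn.comp_continuous (s := Ici 0) ?_ (by fun_prop) fun t => mem_Ici.2 (le_max_left _ _)
  intro t ht
  have h := ((hu 0 (t + 1) Icc_subset_Ici_self).mono_exponent.continuousOn t ⟨ht, by linarith⟩)
  refine h.mono_of_mem_nhdsWithin ?_
  rw [mem_nhdsWithin]
  exact ⟨Iio (t + 1), isOpen_Iio, by simp, fun s hs => ⟨hs.2, hs.1.le⟩⟩

theorem metricDeriv_max_zero (u : ℝ → X) {t : ℝ} (ht : 0 < t) :
    metricDeriv edist (fun t => u (max 0 t)) t = metricDeriv edist u t :=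
  metricDeriv_congr (by
    filter_upwards [Ioi_mem_nhds ht] with s hs
    rw [max_eq_right (le_of_lt hs)])

/-- Coercivity bounds `φ(u)` below by `-B d²(u, x) - C`, and the Poincaré inequality absorbs the
quadratic term into the kinetic energy. The first bound makes the functional well defined, the
second bounds it from below. -/
theorem negPart_energy_le {φ : X → EReal} {ustar : X} {A B ε : ℝ} (hφ : Coercive φ ustar A B)
    (hε : 0 < ε) (hεB : B ≤ 1 / (16 * ε)) {x : X} {u : ℝ → X} (hu : u ∈ admissible ε x) :
    ∫⁻ t, (-lagrangian φ ε (u t) (metricDeriv edist u t)).toENNReal ∂(expMeasure ε) < ⊤ ∧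
    ∫⁻ t, (-lagrangian φ ε (u t) (metricDeriv edist u t)).toENNReal ∂(expMeasure ε) ≤
      ∫⁻ t, (lagrangian φ ε (u t) (metricDeriv edist u t)).toENNReal ∂(expMeasure ε) +
        ENNReal.ofReal (B * dist x ustar ^ 2 + A) := by
  obtain ⟨hac, hx, hfin⟩ := hu
  have := isProbabilityMeasure_expMeasure hε
  have hA := hφ.A_nonneg
  have hB := hφ.B_nonneg
  -- The values of `u` at negative times are arbitrary; the constant extension is continuous, so its
  -- metric derivative is Borel.
  set v : ℝ → X := fun t => u (max 0 t) with hv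
  have hvc : Continuous v := hac.continuous_max_zero
  set g := metricDeriv edist v with hg
  have hgm : Measurable g := measurable_metricDeriv hvc
  have hgu : ∀ t, 0 < t → g t = metricDeriv edist u t := fun t ht => metricDeriv_max_zero u ht
  set C := B * dist x ustar ^ 2 + A with hC
  have hC0 : 0 ≤ C := by positivity
  set b : ℝ → ℝ≥0∞ := fun t => ENNReal.ofReal B * edist x (v t) ^ 2 + ENNReal.ofReal C with hb
  have hvx : Measurable fun t => edist x (v t) :=
    (continuous_const.edist hvc).measurable
  have hbm : Measurable b := by fun_prop
  set q : ℝ → ℝ≥0∞ := fun t => ENNReal.ofReal (ε / 2) * g t ^ 2 with hq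
  have hqm : Measurable q := by fun_prop
  have hpos := ae_expMeasure_pos ε
  have hgfin : ∫⁻ t, g t ^ 2 ∂(expMeasure ε) < ⊤ := by
    refine lt_of_le_of_lt (lintegral_mono_ae ?_) hfin
    filter_upwards [hpos] with t ht
    rw [hgu t ht]
  have hqfin : ∫⁻ t, q t ∂(expMeasure ε) < ⊤ := by
    rw [lintegral_const_mul' _ _ ENNReal.ofReal_ne_top]
    exact ENNReal.mul_lt_top ENNReal.ofReal_lt_top hgfin
  have hP : ∫⁻ t, edist x (v t) ^ 2 ∂(expMeasure ε) ≤
      ENNReal.ofReal (4 * ε ^ 2) * ∫⁻ t, g t ^ 2 ∂(expMeasure ε) := by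
    refine lintegral_sq_primitive_expMeasure_le hε hgm fun t ht => ?_
    have h1 := edist_le_lintegral_metricDeriv ht.le
      (hac 0 t Icc_subset_Ici_self).mono_exponent
    rw [hx, ← restrict_Ioo_eq_restrict_Icc] at h1
    rw [hv, ← restrict_Ioo_eq_restrict_Icc]
    simp only [max_eq_right ht.le]
    exact h1.trans (setLIntegral_mono' measurableSet_Ioo fun r hr => (hgu r hr.1).ge)
  have hbint : ∫⁻ t, b t ∂(expMeasure ε) ≤ ∫⁻ t, q t ∂(expMeasure ε) + ENNReal.ofReal C := by
    rw [lintegral_add_right _ measurable_const, lintegral_const, measure_univ, mul_one,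
      lintegral_const_mul' _ _ ENNReal.ofReal_ne_top,
      lintegral_const_mul' _ _ ENNReal.ofReal_ne_top]
    refine add_le_add ?_ le_rfl
    refine (mul_le_mul' le_rfl hP).trans ?_
    rw [← mul_assoc, ← ENNReal.ofReal_mul hB]
    refine mul_le_mul' (ENNReal.ofReal_le_ofReal ?_) le_rfl
    -- The Poincaré constant gives `4 ε² B ≤ ε/4`, which is below the kinetic coefficient `ε/2`.
    have h1 : B * (16 * ε) ≤ 1 := (le_div_iff₀ (by positivity)).1 hεB
    nlinarith
  have hpt : ∀ t, 0 < t → -(b t : EReal) ≤ φ (u t) := by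
    intro t ht
    -- Coercivity is applied with the starting point `x` as intermediate point, so that the distance
    -- that appears is the one controlled by the Poincaré inequality.
    refine le_trans (le_of_eq ?_) (hφ.le (u t) x)
    have hvt : v t = u t := by simp [hv, ht.le]
    simp only [hb, hvt]
    rw [edist_dist, ← ENNReal.ofReal_pow dist_nonneg, ← ENNReal.ofReal_mul hB,
      ← ENNReal.ofReal_add (by positivity) hC0, EReal.coe_ennreal_ofReal,
      max_eq_left (by positivity), ← EReal.coe_neg]
    rw [dist_comm x (u t), hC]
    congr 1; ring
  have hle : ∀ᵐ t ∂(expMeasure ε), q t +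
      (-lagrangian φ ε (u t) (metricDeriv edist u t)).toENNReal ≤
      (lagrangian φ ε (u t) (metricDeriv edist u t)).toENNReal + b t := by
    filter_upwards [hpos] with t ht
    have := toENNReal_coe_add_add_le (hφ.ne_bot (u t)) (q := q t) (hpt t ht)
    unfold lagrangian
    rw [← hgu t ht]
    exact this
  have hint := lintegral_mono_ae hle
  rw [lintegral_add_left hqm, lintegral_add_right _ hbm] at hint
  constructor
  · refine lt_of_le_of_lt (lintegral_mono_ae ?_)
      (lt_of_le_of_lt hbint (ENNReal.add_lt_top.2 ⟨hqfin, ENNReal.ofReal_lt_top⟩))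
    filter_upwards [hpos] with t ht
    refine (EReal.toENNReal_le_toENNReal (y := (b t : EReal)) ?_).trans_eq EReal.toENNReal_coe
    rw [EReal.neg_le]
    refine (hpt t ht).trans ?_
    unfold lagrangian
    exact le_add_of_nonneg_left (EReal.coe_ennreal_nonneg _)
  · have h2 := hint.trans (add_le_add le_rfl hbint)
    -- The kinetic integral stands on both sides and cancels because it is finite.
    rw [add_left_comm] at h2
    exact (ENNReal.add_le_add_iff_left hqfin.ne).1 h2

/-- Every value of the functional on admissible curves from `x` is bounded below. -/
theorem neg_le_valueFunction {φ : X → EReal} {ustar : X} {A B ε : ℝ} (hφ : Coercive φ ustar A B)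
    (hε : 0 < ε) (hεB : B ≤ 1 / (16 * ε)) (x : X) :
    ((-(B * dist x ustar ^ 2 + A) : ℝ) : EReal) ≤ valueFunction φ ε x := by
  refine le_iInf₂ fun u hu => ?_
  obtain ⟨h1, h2⟩ := negPart_energy_le hφ hε hεB hu
  have hA := hφ.A_nonneg
  have hB := hφ.B_nonneg
  have hC0 : 0 ≤ B * dist x ustar ^ 2 + A := by positivity
  unfold wedFunctional extIntegral
  generalize (∫⁻ t, (-lagrangian φ ε (u t) (metricDeriv edist u t)).toENNReal ∂(expMeasure ε)) = N
    at h1 h2 ⊢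
  generalize (∫⁻ t, (lagrangian φ ε (u t) (metricDeriv edist u t)).toENNReal ∂(expMeasure ε)) = P
    at h2 ⊢
  lift N to NNReal using h1.ne
  rcases eq_or_ne P ⊤ with rfl | hP
  · simp
  lift P to NNReal using hP
  rw [ENNReal.ofReal, ← ENNReal.coe_add, ENNReal.coe_le_coe, ← NNReal.coe_le_coe, NNReal.coe_add,
    Real.coe_toNNReal _ hC0] at h2
  have : (((P : ℝ≥0∞) : EReal) - ((N : ℝ≥0∞) : EReal)) = (((P : ℝ) - N : ℝ) : EReal) := by
    push_cast; rfl
  rw [this, EReal.coe_le_coe_iff]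
  linarith

theorem metricDeriv_const (x : X) (t : ℝ) : metricDeriv edist (fun _ => x) t = 0 := by
  simp [metricDeriv]

/-- The constant curve at `x` is a competitor, and its cost is `φ x` because `μ_ε` has mass one. -/
theorem valueFunction_le {φ : X → EReal} (hφ : ∀ x, φ x ≠ ⊥) {ε : ℝ} (hε : 0 < ε) (x : X) :
    valueFunction φ ε x ≤ φ x := by
  have := isProbabilityMeasure_expMeasure hε
  refine (iInf₂_le (fun _ => x) ⟨fun a b _ => ⟨0, MemLp.zero, by simp⟩, rfl, ?_⟩).trans
    (le_of_eq ?_)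
  · unfold wedFunctional extIntegral lagrangian
    simp only [metricDeriv_const]
    simp only [ne_eq, OfNat.ofNat_ne_zero, not_false_eq_true, zero_pow, mul_zero,
      EReal.coe_ennreal_zero, zero_add, lintegral_const, measure_univ, mul_one]
    rw [EReal.coe_toENNReal_eq_max, EReal.coe_toENNReal_eq_max]
    induction h : φ x with
    | bot => exact absurd h (hφ x)
    | top => simp
    | coe y =>
      rw [← EReal.coe_neg]
      rcases le_total 0 y with hy | hy
      · rw [max_eq_right (EReal.coe_nonneg.2 hy),
          max_eq_left (EReal.coe_nonpos.2 (neg_nonpos.2 hy)), sub_zero]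
      · rw [max_eq_left (EReal.coe_nonpos.2 hy), max_eq_right (EReal.coe_nonneg.2 (neg_nonneg.2 hy)),
          ← EReal.coe_zero, ← EReal.coe_sub, zero_sub, neg_neg]
  · simp [metricDeriv_const]

end WED

namespace WED

/-! ### Affine changes of time and gluing -/

theorem measurableEmbedding_affine {c : ℝ} (hc : c ≠ 0) (d : ℝ) :
    MeasurableEmbedding fun r : ℝ => d + c * r :=
  ((Homeomorph.mulLeft₀ c hc).trans (Homeomorph.addLeft d)).measurableEmbedding

theorem map_affine_restrict {c : ℝ} (hc : c ≠ 0) (d : ℝ) (S : Set ℝ) :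
    (volume.restrict ((fun r : ℝ => d + c * r) ⁻¹' S)).map (fun r => d + c * r) =
      ENNReal.ofReal |c⁻¹| • volume.restrict S := by
  rw [← (measurableEmbedding_affine hc d).restrict_map, ← Measure.restrict_smul,
    ← Real.map_volume_mul_left hc]
  congr 1
  rw [show (fun r : ℝ => d + c * r) = (fun x => d + x) ∘ fun r => c * r from rfl,
    ← Measure.map_map (by fun_prop) (by fun_prop), Real.map_volume_mul_left hc,
    Measure.map_smul, map_add_left_eq_self]

theorem memLp_comp_affine {c : ℝ} (hc : c ≠ 0) (d : ℝ) {S : Set ℝ} {m : ℝ → ℝ} {p : ℝ≥0∞}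
    (hm : MemLp m p (volume.restrict S)) :
    MemLp (fun r => m (d + c * r)) p (volume.restrict ((fun r : ℝ => d + c * r) ⁻¹' S)) := by
  have := (measurableEmbedding_affine hc d).memLp_map_measure_iff (g := m) (p := p)
    (μ := volume.restrict ((fun r : ℝ => d + c * r) ⁻¹' S))
  rw [map_affine_restrict hc] at this
  exact this.1 (hm.smul_measure ENNReal.ofReal_ne_top)

theorem ae_comp_affine {c : ℝ} (hc : c ≠ 0) (d : ℝ) {S : Set ℝ} {P : ℝ → Prop}
    (h : ∀ᵐ t ∂(volume.restrict S), P t) :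
    ∀ᵐ r ∂(volume.restrict ((fun r : ℝ => d + c * r) ⁻¹' S)), P (d + c * r) := by
  have := (measurableEmbedding_affine hc d).ae_map_iff (p := P)
    (μ := volume.restrict ((fun r : ℝ => d + c * r) ⁻¹' S))
  rw [map_affine_restrict hc] at this
  exact this.1 (Measure.ae_smul_measure h _)

theorem affine_preimage_Icc {c : ℝ} (hc : 0 < c) (d a b : ℝ) :
    (fun r : ℝ => d + c * r) ⁻¹' Icc a b = Icc ((a - d) / c) ((b - d) / c) := by
  ext r
  simp only [mem_preimage, mem_Icc, div_le_iff₀ hc, le_div_iff₀ hc]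
  constructor <;> rintro ⟨h1, h2⟩ <;> constructor <;> linarith

theorem neg_affine_preimage_Icc (a b : ℝ) :
    (fun r : ℝ => (a + b) + (-1) * r) ⁻¹' Icc a b = Icc a b := by
  ext r
  simp only [mem_preimage, mem_Icc]
  constructor <;> rintro ⟨h1, h2⟩ <;> constructor <;> linarith

variable {X : Type*}

theorem ACCurve.congr {δ : X → X → ℝ≥0∞} {p : ℝ≥0∞} {I : Set ℝ} {u v : ℝ → X}
    (hu : ACCurve δ p I u) (h : EqOn v u I) : ACCurve δ p I v := by
  obtain ⟨m, hm, hd⟩ := hu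
  exact ⟨m, hm, fun s hs t ht hst => by rw [h hs, h ht]; exact hd s hs t ht hst⟩

theorem ACCurve.comp_sub {δ : X → X → ℝ≥0∞} {p : ℝ≥0∞} {a b : ℝ} {u : ℝ → X}
    (hu : ACCurve δ p (Icc a b) u) (T : ℝ) :
    ACCurve δ p (Icc (a + T) (b + T)) fun t => u (t - T) := by
  obtain ⟨m, hm, hd⟩ := hu
  have h1 := memLp_comp_affine one_ne_zero (-T) hm
  rw [affine_preimage_Icc one_pos] at h1
  simp only [sub_neg_eq_add, div_one, one_mul, neg_add_eq_sub] at h1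
  refine ⟨fun t => m (t - T), h1, fun s hs t ht hst => ?_⟩
  rw [intervalIntegral.integral_comp_sub_right]
  exact hd _ ⟨by linarith [hs.1], by linarith [hs.2]⟩ _ ⟨by linarith [ht.1], by linarith [ht.2]⟩
    (by linarith)

theorem ACCurve.exists_nonneg {δ : X → X → ℝ≥0∞} {p : ℝ≥0∞} {I : Set ℝ} {u : ℝ → X}
    (hu : ACCurve δ p I u) : ∃ m : ℝ → ℝ, (∀ t, 0 ≤ m t) ∧ MemLp m p (volume.restrict I) ∧
      ∀ s ∈ I, ∀ t ∈ I, s ≤ t → δ (u s) (u t) ≤ ENNReal.ofReal (∫ r in s..t, m r) := by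
  obtain ⟨m, hm, hd⟩ := hu
  refine ⟨fun t => |m t|, fun t => abs_nonneg _, hm.abs, fun s hs t ht hst =>
    (hd s hs t ht hst).trans (ENNReal.ofReal_le_ofReal ?_)⟩
  exact (le_abs_self _).trans (intervalIntegral.abs_integral_le_integral_abs hst)

variable [MetricSpace X]

theorem ACCurve.glue {p : ℝ≥0∞} (hp : 1 ≤ p) {a b c : ℝ} {u : ℝ → X}
    (h1 : ACCurve edist p (Icc a c) u) (h2 : ACCurve edist p (Icc c b) u) :
    ACCurve edist p (Icc a b) u := by
  obtain ⟨m1, hm1, hL1, hd1⟩ := h1.exists_nonneg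
  obtain ⟨m2, hm2, hL2, hd2⟩ := h2.exists_nonneg
  -- The two densities overlap only at `c`. Their nonnegativity lets the sum dominate either one,
  -- and an interval straddling `c` is split by the triangle inequality.
  set m : ℝ → ℝ := (Icc a c).indicator m1 + (Icc c b).indicator m2 with hm
  have hL : MemLp m p volume := ((memLp_indicator_iff_restrict measurableSet_Icc).2 hL1).add
    ((memLp_indicator_iff_restrict measurableSet_Icc).2 hL2)
  have hi : ∀ s t, s ≤ t → IntervalIntegrable m volume s t := fun s t hst =>
    ACCurve.intervalIntegrable hp (subset_univ _) hst (by simpa using hL)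
  have hm0 : ∀ t, 0 ≤ m t := fun t => add_nonneg (indicator_nonneg (fun _ _ => hm1 _) _)
    (indicator_nonneg (fun _ _ => hm2 _) _)
  have k1 : ∀ s t, s ≤ t → a ≤ s → t ≤ c → edist (u s) (u t) ≤ ENNReal.ofReal (∫ r in s..t, m r) := by
    intro s t hst hs ht
    refine (hd1 s ⟨hs, hst.trans ht⟩ t ⟨hs.trans hst, ht⟩ hst).trans (ENNReal.ofReal_le_ofReal ?_)
    refine intervalIntegral.integral_mono_on hst
      (ACCurve.intervalIntegrable hp (Icc_subset_Icc hs ht) hst hL1) (hi s t hst) fun r hr => ?_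
    rw [hm, Pi.add_apply, indicator_of_mem (show r ∈ Icc a c from ⟨hs.trans hr.1, hr.2.trans ht⟩)]
    exact le_add_of_nonneg_right (indicator_nonneg (fun _ _ => hm2 _) _)
  have k2 : ∀ s t, s ≤ t → c ≤ s → t ≤ b → edist (u s) (u t) ≤ ENNReal.ofReal (∫ r in s..t, m r) := by
    intro s t hst hs ht
    refine (hd2 s ⟨hs, hst.trans ht⟩ t ⟨hs.trans hst, ht⟩ hst).trans (ENNReal.ofReal_le_ofReal ?_)
    refine intervalIntegral.integral_mono_on hst
      (ACCurve.intervalIntegrable hp (Icc_subset_Icc hs ht) hst hL2) (hi s t hst) fun r hr => ?_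
    rw [hm, Pi.add_apply, indicator_of_mem (show r ∈ Icc c b from ⟨hs.trans hr.1, hr.2.trans ht⟩)]
    exact le_add_of_nonneg_left (indicator_nonneg (fun _ _ => hm1 _) _)
  refine ⟨m, hL.restrict _, fun s hs t ht hst => ?_⟩
  rcases le_total t c with htc | htc
  · exact k1 s t hst hs.1 htc
  rcases le_total c s with hcs | hcs
  · exact k2 s t hst hcs ht.2
  refine (edist_triangle _ (u c) _).trans ((add_le_add (k1 s c hcs hs.1 le_rfl)
    (k2 c t htc le_rfl ht.2)).trans ?_)
  rw [← ENNReal.ofReal_add (intervalIntegral.integral_nonneg hcs fun _ _ => hm0 _)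
    (intervalIntegral.integral_nonneg htc fun _ _ => hm0 _),
    intervalIntegral.integral_add_adjacent_intervals (hi s c hcs) (hi c t htc)]

/-! ### Curves with square-integrable speed and integrable energy -/

/-- The curve `w` on `[a, b]` has speed at most `m ∈ L²`, and its energy is a.e. equal to the
integrable function `ψ`. -/
structure EnergyCurve (φ : X → EReal) (a b : ℝ) (w : ℝ → X) (m ψ : ℝ → ℝ) : Prop where
  nonneg : ∀ t, 0 ≤ m t
  memLp : MemLp m 2 (volume.restrict (Icc a b))
  edist_le : ∀ s ∈ Icc a b, ∀ t ∈ Icc a b, s ≤ t →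
    edist (w s) (w t) ≤ ENNReal.ofReal (∫ r in s..t, m r)
  integrable : IntegrableOn ψ (Icc a b)
  ae_eq : ∀ᵐ t ∂(volume.restrict (Icc a b)), φ (w t) = (ψ t : EReal)

namespace EnergyCurve

variable {φ : X → EReal} {a b : ℝ} {w : ℝ → X} {m ψ : ℝ → ℝ}

theorem acCurve (h : EnergyCurve φ a b w m ψ) : ACCurve edist 2 (Icc a b) w :=
  ⟨m, h.memLp, h.edist_le⟩

theorem mono (h : EnergyCurve φ a b w m ψ) {s t : ℝ} (hst : Icc s t ⊆ Icc a b) :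
    EnergyCurve φ s t w m ψ where
  nonneg := h.nonneg
  memLp := h.memLp.mono_measure (Measure.restrict_mono hst le_rfl)
  edist_le := fun r hr r' hr' => h.edist_le r (hst hr) r' (hst hr')
  integrable := h.integrable.mono_set hst
  ae_eq := ae_restrict_of_ae_restrict_of_subset hst h.ae_eq

theorem comp_affine (h : EnergyCurve φ a b w m ψ) {c : ℝ} (hc : 0 < c) (d : ℝ) :
    EnergyCurve φ ((a - d) / c) ((b - d) / c) (fun r => w (d + c * r))
      (fun r => c * m (d + c * r)) (fun r => ψ (d + c * r)) where
  nonneg := fun t => mul_nonneg hc.le (h.nonneg _)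
  memLp := by
    have := memLp_comp_affine hc.ne' d h.memLp
    rw [affine_preimage_Icc hc] at this
    exact this.const_mul c
  edist_le := fun s hs t ht hst => by
    rw [← affine_preimage_Icc hc] at hs ht
    rw [intervalIntegral.integral_const_mul, intervalIntegral.integral_comp_add_mul _ hc.ne',
      smul_eq_mul, mul_inv_cancel_left₀ hc.ne']
    exact h.edist_le _ hs _ ht (by nlinarith)
  integrable := by
    have := memLp_comp_affine hc.ne' d (memLp_one_iff_integrable.2 h.integrable)
    rw [affine_preimage_Icc hc] at this
    exact memLp_one_iff_integrable.1 this
  ae_eq := by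
    have := ae_comp_affine hc.ne' d h.ae_eq
    rwa [affine_preimage_Icc hc] at this

/-- Symmetry of the distance makes this possible. It is the device that turns every one-sided
consequence of dynamic programming into a two-sided one. -/
theorem reverse (h : EnergyCurve φ a b w m ψ) :
    EnergyCurve φ a b (fun r => w (a + b - r)) (fun r => m (a + b - r))
      (fun r => ψ (a + b - r)) where
  nonneg := fun t => h.nonneg _
  memLp := by
    have := memLp_comp_affine (neg_ne_zero.2 one_ne_zero) (a + b) h.memLp
    rw [neg_affine_preimage_Icc] at this
    simpa only [neg_one_mul, ← sub_eq_add_neg] using this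
  edist_le := fun s hs t ht hst => by
    rw [intervalIntegral.integral_comp_sub_left, edist_comm]
    exact h.edist_le _ ⟨by linarith [ht.2], by linarith [ht.1]⟩ _
      ⟨by linarith [hs.2], by linarith [hs.1]⟩ (by linarith)
  integrable := by
    have := memLp_comp_affine (neg_ne_zero.2 one_ne_zero) (a + b)
      (memLp_one_iff_integrable.2 h.integrable)
    rw [neg_affine_preimage_Icc] at this
    simpa only [neg_one_mul, ← sub_eq_add_neg, IntegrableOn] using memLp_one_iff_integrable.1 this
  ae_eq := by
    have := ae_comp_affine (neg_ne_zero.2 one_ne_zero) (a + b) h.ae_eq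
    rw [neg_affine_preimage_Icc] at this
    simpa only [neg_one_mul, ← sub_eq_add_neg] using this

end EnergyCurve

end WED

namespace WED

variable {X : Type*}

/-! ### The dynamic programming principle -/

/-- The curve that follows `w` up to time `T` and then `v`. -/
noncomputable def concat (T : ℝ) (w v : ℝ → X) (t : ℝ) : X := if t ≤ T then w t else v (t - T)

theorem concat_of_le {T t : ℝ} (w v : ℝ → X) (h : t ≤ T) : concat T w v t = w t := if_pos h

theorem concat_of_ge {T t : ℝ} {w v : ℝ → X} (hv : v 0 = w T) (h : T ≤ t) :
    concat T w v t = v (t - T) := by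
  rcases h.eq_or_lt with rfl | h
  · simp [concat, hv]
  · exact if_neg (not_le.2 h)

variable [MetricSpace X]

theorem metricDeriv_concat_of_lt {T t : ℝ} (w v : ℝ → X) (h : t < T) :
    metricDeriv edist (concat T w v) t = metricDeriv edist w t :=
  metricDeriv_congr (by
    filter_upwards [Iio_mem_nhds h] with s hs using concat_of_le w v (le_of_lt hs))

theorem metricDeriv_concat_add {T t : ℝ} (w v : ℝ → X) (h : 0 < t) :
    metricDeriv edist (concat T w v) (t + T) = metricDeriv edist v t := by
  rw [← metricDeriv_comp_add]
  refine metricDeriv_congr ?_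
  filter_upwards [Ioi_mem_nhds h] with s hs
  have hs : 0 < s := hs
  rw [concat, if_neg (by linarith), add_sub_cancel_right]

/-- Memorylessness in the form used for dynamic programming: after time `T` the same integral starts
afresh, discounted by `e^{-T/ε}`. -/
theorem lintegral_expMeasure_split {ε T : ℝ} (hT : 0 ≤ T) (F : ℝ → ℝ≥0∞) :
    ∫⁻ t, F t ∂(expMeasure ε) =
      (∫⁻ t in Icc 0 T, ENNReal.ofReal (Real.exp (-t / ε) / ε) * F t) +
        ENNReal.ofReal (Real.exp (-T / ε)) * ∫⁻ t, F (t + T) ∂(expMeasure ε) := by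
  rw [← lintegral_add_compl F (measurableSet_Iic (a := T)), compl_Iic,
    setLIntegral_expMeasure_Ioi hT, setLIntegral_expMeasure measurableSet_Iic, inter_comm,
    Ioi_inter_Iic, restrict_Ioc_eq_restrict_Icc]

theorem acCurveLoc_concat {T : ℝ} (hT : 0 ≤ T) {w v : ℝ → X} (hw : ACCurve edist 2 (Icc 0 T) w)
    (hv : ACCurveLoc edist 2 (Ici 0) v) (h0 : v 0 = w T) :
    ACCurveLoc edist 2 (Ici 0) (concat T w v) := by
  intro a b hab
  rcases lt_or_ge b a with hba | hba
  · exact ⟨0, MemLp.zero, by simp [Icc_eq_empty_of_lt hba]⟩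
  have ha : 0 ≤ a := hab (left_mem_Icc.2 hba)
  have h1 : ACCurve edist 2 (Icc 0 T) (concat T w v) :=
    hw.congr fun t ht => concat_of_le w v ht.2
  have h2 : ACCurve edist 2 (Icc T (b + T)) (concat T w v) := by
    have := (hv 0 b Icc_subset_Ici_self).comp_sub T
    rw [zero_add] at this
    exact this.congr fun t ht => concat_of_ge h0 ht.1
  exact (h1.glue one_le_two h2).mono (Icc_subset_Icc ha (by linarith))

theorem EnergyCurve.ae_metricDeriv_le {φ : X → EReal} {a b : ℝ} {w : ℝ → X} {m ψ : ℝ → ℝ}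
    (hab : a ≤ b) (h : EnergyCurve φ a b w m ψ) :
    ∀ᵐ t ∂(volume.restrict (Icc a b)), metricDeriv edist w t ≤ ENNReal.ofReal (m t) := by
  have := WED.ae_metricDeriv_le (δ := edist) edist_comm hab
    (ACCurve.intervalIntegrable one_le_two subset_rfl hab h.memLp) h.edist_le
  filter_upwards [this] with t ht
  rwa [abs_of_nonneg (h.nonneg t)] at ht

theorem exp_div_le_of_mem {ε t : ℝ} (hε : 0 < ε) (ht : 0 ≤ t) : Real.exp (-t / ε) / ε ≤ 1 / ε := by
  refine div_le_div_of_nonneg_right (Real.exp_le_one_iff.2 ?_) hε.le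
  rw [neg_div, neg_nonpos]
  positivity

theorem concat_mem_admissible {φ : X → EReal} {ε T : ℝ} (hε : 0 < ε) (hT : 0 ≤ T) {w v : ℝ → X}
    {m ψ : ℝ → ℝ} (h : EnergyCurve φ 0 T w m ψ) (hv : v ∈ admissible ε (w T)) :
    concat T w v ∈ admissible ε (w 0) := by
  obtain ⟨hac, h0, hfin⟩ := hv
  refine ⟨acCurveLoc_concat hT h.acCurve hac h0, concat_of_le w v hT, ?_⟩
  rw [lintegral_expMeasure_split hT]
  refine ENNReal.add_lt_top.2 ⟨?_, ENNReal.mul_lt_top ENNReal.ofReal_lt_top ?_⟩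
  · have hsq : ∫⁻ t in Icc 0 T, ENNReal.ofReal (1 / ε * m t ^ 2) < ⊤ :=
      (h.memLp.integrable_sq.const_mul (1 / ε)).lintegral_lt_top
    refine lt_of_le_of_lt (lintegral_mono_ae ?_) hsq
    rw [← restrict_Ico_eq_restrict_Icc]
    have h1 := ae_restrict_of_ae_restrict_of_subset Ico_subset_Icc_self (h.ae_metricDeriv_le hT)
    filter_upwards [h1, ae_restrict_mem measurableSet_Ico] with t ht hts
    rw [metricDeriv_concat_of_lt w v hts.2, ENNReal.ofReal_mul (by positivity),
      ENNReal.ofReal_pow (h.nonneg t)]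
    exact mul_le_mul' (ENNReal.ofReal_le_ofReal (exp_div_le_of_mem hε hts.1))
      (pow_le_pow_left₀ zero_le ht 2)
  · refine lt_of_le_of_lt (lintegral_mono_ae ?_) hfin
    filter_upwards [ae_expMeasure_pos ε] with t ht
    rw [metricDeriv_concat_add w v ht]

/-- The dynamic programming inequality. -/
theorem valueFunction_le_of_energyCurve {φ : X → EReal} {ustar : X} {A B ε : ℝ}
    (hφ : Coercive φ ustar A B) (hε : 0 < ε) (hεB : B ≤ 1 / (16 * ε)) {T : ℝ} (hT : 0 ≤ T)
    {w : ℝ → X} {m ψ : ℝ → ℝ} (h : EnergyCurve φ 0 T w m ψ) {c : ℝ}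
    (hc : valueFunction φ ε (w T) < c) :
    valueFunction φ ε (w 0) ≤ (((∫ r in 0..T, (m r ^ 2 / 2 + ψ r / ε) * Real.exp (-r / ε)) +
      Real.exp (-T / ε) * c : ℝ) : EReal) := by
  -- The slack `c` replaces the value itself, so that a competitor `v` suffices and no minimizer is
  -- needed.
  obtain ⟨v, hv⟩ := iInf_lt_iff.1 hc
  obtain ⟨hva, hvc⟩ := iInf_lt_iff.1 hv
  obtain ⟨hN, -⟩ := negPart_energy_le hφ hε hεB hva
  have hz := concat_mem_admissible hε hT h hva
  refine (iInf₂_le _ hz).trans ?_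
  set K : ℝ → ℝ := fun r => (m r ^ 2 / 2 + ψ r / ε) * Real.exp (-r / ε) with hK
  have hKi : IntegrableOn K (Icc 0 T) := by
    have h1 : IntegrableOn (fun r => m r ^ 2 / 2 + ψ r / ε) (Icc 0 T) :=
      (h.memLp.integrable_sq.div_const 2).add (h.integrable.div_const ε)
    exact h1.mul_continuousOn (by fun_prop) isCompact_Icc
  set z := concat T w v with hzdef
  have hleft : ∀ᵐ t ∂(volume.restrict (Icc 0 T)),
      lagrangian φ ε (z t) (metricDeriv edist z t) ≤ ((ε / 2 * m t ^ 2 + ψ t : ℝ) : EReal) := by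
    rw [← restrict_Ico_eq_restrict_Icc]
    have h1 := ae_restrict_of_ae_restrict_of_subset Ico_subset_Icc_self (h.ae_metricDeriv_le hT)
    have h2 := ae_restrict_of_ae_restrict_of_subset Ico_subset_Icc_self h.ae_eq
    filter_upwards [h1, h2, ae_restrict_mem measurableSet_Ico] with t ht ht2 hts
    rw [lagrangian, hzdef, metricDeriv_concat_of_lt w v hts.2, concat_of_le w v hts.2.le, ht2,
      EReal.coe_add]
    refine add_le_add ?_ le_rfl
    have h3 : ENNReal.ofReal (ε / 2) * metricDeriv edist w t ^ 2 ≤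
        ENNReal.ofReal (ε / 2 * m t ^ 2) := by
      rw [ENNReal.ofReal_mul (by positivity), ENNReal.ofReal_pow (h.nonneg t)]
      exact mul_le_mul' le_rfl (pow_le_pow_left₀ zero_le ht 2)
    refine (EReal.coe_ennreal_le_coe_ennreal_iff.2 h3).trans_eq ?_
    rw [EReal.coe_ennreal_ofReal, max_eq_left (by positivity)]
  have hKL : ∀ t, Real.exp (-t / ε) / ε * (ε / 2 * m t ^ 2 + ψ t) = K t := fun t => by
    simp only [hK]; field_simp
  have hright : ∀ t, 0 < t → lagrangian φ ε (z (t + T)) (metricDeriv edist z (t + T)) =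
      lagrangian φ ε (v t) (metricDeriv edist v t) := fun t ht => by
    rw [hzdef, metricDeriv_concat_add w v ht, concat_of_ge hva.2.1 (by linarith),
      add_sub_cancel_right]
  unfold wedFunctional extIntegral at hvc ⊢
  set P := ∫⁻ t, (lagrangian φ ε (v t) (metricDeriv edist v t)).toENNReal ∂(expMeasure ε) with hP
  set N := ∫⁻ t, (-lagrangian φ ε (v t) (metricDeriv edist v t)).toENNReal ∂(expMeasure ε)
    with hNdef
  -- The functional is a difference of two lower integrals, so the positive part is bounded from
  -- above and, in `hn`, the negative part from below.
  have hp : ∫⁻ t, (lagrangian φ ε (z t) (metricDeriv edist z t)).toENNReal ∂(expMeasure ε) ≤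
      (∫⁻ t in Icc 0 T, ENNReal.ofReal (K t)) + ENNReal.ofReal (Real.exp (-T / ε)) * P := by
    rw [lintegral_expMeasure_split hT]
    refine add_le_add (lintegral_mono_ae ?_) (mul_le_mul' le_rfl (lintegral_mono_ae ?_))
    · filter_upwards [hleft] with t ht
      rw [← hKL, ENNReal.ofReal_mul (by positivity), ← EReal.real_coe_toENNReal (_ + _)]
      exact mul_le_mul' le_rfl (EReal.toENNReal_le_toENNReal ht)
    · filter_upwards [ae_expMeasure_pos ε] with t ht
      rw [hright t ht]
  have hn : (∫⁻ t in Icc 0 T, ENNReal.ofReal (-K t)) + ENNReal.ofReal (Real.exp (-T / ε)) * N ≤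
      ∫⁻ t, (-lagrangian φ ε (z t) (metricDeriv edist z t)).toENNReal ∂(expMeasure ε) := by
    rw [lintegral_expMeasure_split hT]
    refine add_le_add (lintegral_mono_ae ?_) (mul_le_mul' le_rfl (lintegral_mono_ae ?_))
    · filter_upwards [hleft] with t ht
      rw [← hKL, ← mul_neg, ENNReal.ofReal_mul (by positivity),
        ← EReal.real_coe_toENNReal (-(_ + _)), EReal.coe_neg]
      exact mul_le_mul' le_rfl (EReal.toENNReal_le_toENNReal (EReal.neg_le_neg_iff.2 ht))
    · filter_upwards [ae_expMeasure_pos ε] with t ht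
      rw [hright t ht]
  -- The negative part is finite, so an infinite positive part would make the cost of `v` infinite
  -- and not below `c`.
  have hPtop : P ≠ ⊤ := by
    intro hPt
    rw [hPt] at hvc
    rw [← ENNReal.coe_toNNReal hN.ne] at hvc
    simp at hvc
  have hIeq := integral_eq_lintegral_pos_part_sub_lintegral_neg_part hKi
  have ha1 : ∫⁻ t in Icc 0 T, ENNReal.ofReal (K t) ≠ ⊤ := hKi.lintegral_lt_top.ne
  have ha2 : ∫⁻ t in Icc 0 T, ENNReal.ofReal (-K t) ≠ ⊤ := hKi.neg.lintegral_lt_top.ne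
  refine (EReal.sub_le_sub (EReal.coe_ennreal_le_coe_ennreal_iff.2 hp)
    (EReal.coe_ennreal_le_coe_ennreal_iff.2 hn)).trans ?_
  rw [intervalIntegral.integral_of_le hT, ← integral_Icc_eq_integral_Ioc, hIeq]
  clear_value P N
  generalize ∫⁻ t in Icc 0 T, ENNReal.ofReal (K t) = a1 at ha1 ⊢
  generalize ∫⁻ t in Icc 0 T, ENNReal.ofReal (-K t) = a2 at ha2 ⊢
  lift P to NNReal using hPtop
  lift N to NNReal using hN.ne
  lift a1 to NNReal using ha1
  lift a2 to NNReal using ha2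
  have hco : ∀ y : NNReal, ((y : ℝ≥0∞) : EReal) = ((y : ℝ) : EReal) := fun _ => rfl
  have he := Real.exp_pos (-T / ε)
  rw [hco, hco, ← EReal.coe_sub, EReal.coe_lt_coe_iff] at hvc
  rw [ENNReal.ofReal, ← ENNReal.coe_mul, ← ENNReal.coe_mul, ← ENNReal.coe_add, ← ENNReal.coe_add,
    hco, hco, ← EReal.coe_sub, EReal.coe_le_coe_iff]
  push_cast
  rw [Real.coe_toNNReal _ he.le, ENNReal.coe_toReal, ENNReal.coe_toReal]
  nlinarith

/-- The dynamic programming inequality along `w` run with speed factor `l`. -/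
theorem EnergyCurve.valueFunction_le {φ : X → EReal} {ustar : X} {A B ε : ℝ}
    (hφ : Coercive φ ustar A B) (hε : 0 < ε) (hεB : B ≤ 1 / (16 * ε)) {s t : ℝ} (hst : s ≤ t)
    {w : ℝ → X} {m ψ : ℝ → ℝ} (h : EnergyCurve φ s t w m ψ) {l : ℝ} (hl : 0 < l) {c : ℝ}
    (hc : valueFunction φ ε (w t) < c) :
    valueFunction φ ε (w s) ≤
      (((∫ r in s..t, (l * m r ^ 2 / 2 + ψ r / (l * ε)) * Real.exp (-(r - s) / (l * ε))) +
        Real.exp (-(t - s) / (l * ε)) * c : ℝ) : EReal) := by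
  have h1 := h.comp_affine hl s
  rw [sub_self, zero_div] at h1
  have hT : s + l * ((t - s) / l) = t := by field_simp; ring
  have h2 := valueFunction_le_of_energyCurve hφ hε hεB (div_nonneg (sub_nonneg.2 hst) hl.le) h1
    (c := c) (by rwa [hT])
  rw [mul_zero, add_zero] at h2
  refine h2.trans (le_of_eq ?_)
  congr 2
  -- The squared speed contributes `l²` and the substitution `s + l r` contributes `l⁻¹`; this
  -- leaves `l` on the kinetic term and `1/l` on the energy.
  · have h3 := intervalIntegral.integral_comp_add_mul (a := 0) (b := (t - s) / l)
      (fun r => (l ^ 2 * m r ^ 2 / 2 + ψ r / ε) * Real.exp (-(r - s) / (l * ε))) hl.ne' s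
    rw [hT, mul_zero, add_zero, smul_eq_mul, ← intervalIntegral.integral_const_mul] at h3
    have e1 : ∀ r, ((l * m (s + l * r)) ^ 2 / 2 + ψ (s + l * r) / ε) * Real.exp (-r / ε) =
        (l ^ 2 * m (s + l * r) ^ 2 / 2 + ψ (s + l * r) / ε) *
          Real.exp (-(s + l * r - s) / (l * ε)) := fun r => by
      rw [mul_pow]
      congr 2
      field_simp; ring
    have e2 : ∀ r, l⁻¹ * ((l ^ 2 * m r ^ 2 / 2 + ψ r / ε) * Real.exp (-(r - s) / (l * ε))) =
        (l * m r ^ 2 / 2 + ψ r / (l * ε)) * Real.exp (-(r - s) / (l * ε)) := fun r => by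
      field_simp
    simp only [e1, h3, e2]
  · congr 2
    field_simp

end WED

namespace WED

/-! ### The Hamilton-Jacobi inequality along curves -/

/-- The right-hand side has infimum `m √g` over `l > 0`. Rational `l` suffice by density, and they
allow a countable union of null sets when the hypothesis holds only a.e. for each `l`. -/
theorem le_mul_sqrt_of_forall_rat {x m g : ℝ} (hm : 0 ≤ m) (hg : 0 ≤ g)
    (h : ∀ l : ℚ, 0 < l → x ≤ l * m ^ 2 / 2 + g / (2 * l)) : x ≤ m * √g := by
  rcases le_or_gt x 0 with hx | hx
  · exact hx.trans (by positivity)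
  have hreal : ∀ l : ℝ, 0 < l → 2 * l * x ≤ l ^ 2 * m ^ 2 + g := by
    have hcl : IsClosed {l : ℝ | 2 * l * x ≤ l ^ 2 * m ^ 2 + g} :=
      isClosed_le (by fun_prop) (by fun_prop)
    have hsub := (Rat.isDenseEmbedding_coe_real.dense).open_subset_closure_inter
      (isOpen_Ioi (a := (0 : ℝ)))
    intro l hl
    refine hcl.closure_subset_iff.2 ?_ (hsub hl)
    rintro _ ⟨hq, q, rfl⟩
    have hq : (0 : ℝ) < q := hq
    have h1 := h q (by exact_mod_cast hq)
    have h2 : 2 * (q : ℝ) * (q * m ^ 2 / 2 + g / (2 * q)) = q ^ 2 * m ^ 2 + g := by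
      field_simp
    have h3 := mul_le_mul_of_nonneg_left h1 (by positivity : 0 ≤ 2 * (q : ℝ))
    simp only [mem_ofPred_eq]
    linarith
  -- The quadratic `m² l² - 2 x l + g` is nonnegative for every real `l`: for `l ≤ 0` this follows
  -- from `x > 0`. Its discriminant also covers `m = 0`, where no optimal `l` need exist.
  have hd := discrim_le_zero (a := m ^ 2) (b := -(2 * x)) (c := g) fun l => by
    rcases le_or_gt l 0 with hl | hl
    · have : 0 ≤ -(2 * x) * l := by nlinarith
      nlinarith [mul_nonneg (sq_nonneg m) (mul_self_nonneg l)]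
    · nlinarith [hreal l hl]
  rw [discrim] at hd
  refine abs_le_of_sq_le_sq' ?_ (by positivity) |>.2
  rw [mul_pow, Real.sq_sqrt hg]
  nlinarith

/-- Multiplied by `e^{-κ s}`, the hypothesis says that `Z s = e^{-κ s} W s + ∫_a^s K` is
nondecreasing. Where `W` and the integral are both differentiable, `Z' ≥ 0` is the claim after
division by the exponential. -/
theorem ae_neg_deriv_le {W m ψ : ℝ → ℝ} {a b ε l : ℝ} (hab : a ≤ b) (hε : 0 < ε) (hl : 0 < l)
    (hm : IntegrableOn (fun t => m t ^ 2) (Icc a b)) (hψ : IntegrableOn ψ (Icc a b))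
    (hW : AbsolutelyContinuousOnInterval W a b)
    (h : ∀ s ∈ Icc a b, ∀ t ∈ Icc a b, s ≤ t →
      W s ≤ (∫ r in s..t, (l * m r ^ 2 / 2 + ψ r / (l * ε)) * Real.exp (-(r - s) / (l * ε))) +
        Real.exp (-(t - s) / (l * ε)) * W t) :
    ∀ᵐ t ∂(volume.restrict (Icc a b)),
      -deriv W t ≤ l * m t ^ 2 / 2 + (ψ t - W t) / (l * ε) := by
  set L : ℝ → ℝ := fun r => l * m r ^ 2 / 2 + ψ r / (l * ε) with hL
  have hle : 0 < l * ε := by positivity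
  set κ := (l * ε)⁻¹ with hκ
  set K : ℝ → ℝ := fun r => L r * Real.exp (-κ * r) with hK
  have hLi : IntegrableOn L (Icc a b) :=
    ((hm.const_mul l).div_const 2).add (hψ.div_const _)
  have hKi : IntegrableOn K (Icc a b) := hLi.mul_continuousOn (by fun_prop) isCompact_Icc
  have hKi' : IntervalIntegrable K volume a b :=
    (intervalIntegrable_iff_integrableOn_Icc_of_le hab).2 hKi
  have hi : ∀ s ∈ Icc a b, IntervalIntegrable K volume a s := fun s hs =>
    hKi'.mono_set (by rw [uIcc_of_le hs.1, uIcc_of_le hab]; exact Icc_subset_Icc le_rfl hs.2)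
  set Z : ℝ → ℝ := fun s => Real.exp (-κ * s) * W s + ∫ r in a..s, K r with hZ
  have hmono : MonotoneOn Z (Icc a b) := by
    intro s hs t ht hst
    have h1 := mul_le_mul_of_nonneg_left (h s hs t ht hst) (Real.exp_pos (-κ * s)).le
    have e1 : ∀ r, Real.exp (-κ * s) * ((l * m r ^ 2 / 2 + ψ r / (l * ε)) *
        Real.exp (-(r - s) / (l * ε))) = K r := fun r => by
      rw [mul_left_comm, ← Real.exp_add, hK]
      congr 2
      rw [hκ]; field_simp; ring
    have e2 : Real.exp (-κ * s) * Real.exp (-(t - s) / (l * ε)) = Real.exp (-κ * t) := by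
      rw [← Real.exp_add]
      congr 1
      rw [hκ]; field_simp; ring
    rw [mul_add, ← intervalIntegral.integral_const_mul, ← mul_assoc, e2] at h1
    simp only [e1] at h1
    rw [← intervalIntegral.integral_interval_sub_left (hi t ht) (hi s hs)] at h1
    simp only [hZ]
    linarith
  rw [← restrict_Ioo_eq_restrict_Icc, ae_restrict_iff' measurableSet_Ioo]
  filter_upwards [hW.ae_differentiableAt, hKi'.ae_hasDerivAt_integral] with t h1 h2 hts
  rw [uIcc_of_le hab] at h1 h2
  have hts' := Ioo_subset_Icc_self hts
  have hd1 := (h1 hts').hasDerivAt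
  have hd2 := h2 hts' a (left_mem_Icc.2 hab)
  have hde : HasDerivAt (fun s => Real.exp (-κ * s)) (Real.exp (-κ * t) * (-κ * 1)) t :=
    ((hasDerivAt_id t).const_mul (-κ)).exp
  have hdZ : HasDerivAt Z _ t := (hde.mul hd1).add hd2
  have hacc : AccPt t (𝓟 (Ioo a b)) := accPt_iff_frequently_nhdsNE.2
    (Eventually.frequently (nhdsWithin_le_nhds (isOpen_Ioo.mem_nhds hts)))
  have hnn := hdZ.hasDerivWithinAt.nonneg_of_monotoneOn hacc (hmono.mono Ioo_subset_Icc_self)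
  have hfac : Real.exp (-κ * t) * (-κ * 1) * W t + Real.exp (-κ * t) * deriv W t + K t =
      Real.exp (-κ * t) * (-κ * W t + deriv W t + L t) := by
    simp only [hK]; ring
  rw [hfac] at hnn
  have hnn' := nonneg_of_mul_nonneg_right hnn (Real.exp_pos _)
  have hfin : (ψ t - W t) / (l * ε) = ψ t / (l * ε) - κ * W t := by
    rw [hκ]; field_simp
  rw [hfin]
  simp only [hL] at hnn'
  linarith

theorem setLIntegral_Icc_comp_sub_left (a b : ℝ) (F : ℝ → ℝ≥0∞) :
    ∫⁻ t in Icc a b, F (a + b - t) = ∫⁻ t in Icc a b, F t := by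
  rw [← lintegral_indicator measurableSet_Icc, ← lintegral_indicator measurableSet_Icc,
    ← lintegral_sub_left_eq_self _ (a + b)]
  refine lintegral_congr fun t => ?_
  by_cases ht : t ∈ Icc a b
  · rw [indicator_of_mem ht, indicator_of_mem
      (show a + b - t ∈ Icc a b from ⟨by linarith [ht.2], by linarith [ht.1]⟩),
      sub_sub_cancel]
  · rw [indicator_of_notMem ht, indicator_of_notMem (s := Icc a b) fun h => ht
      ⟨by linarith [h.2], by linarith [h.1]⟩]

theorem ofReal_integral_le_lintegral_ofReal {α : Type*} [MeasurableSpace α] {μ : Measure α}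
    {f : α → ℝ} (hf : Integrable f μ) :
    ENNReal.ofReal (∫ t, f t ∂μ) ≤ ∫⁻ t, ENNReal.ofReal (f t) ∂μ := by
  rw [integral_eq_lintegral_pos_part_sub_lintegral_neg_part hf]
  refine (ENNReal.ofReal_le_ofReal (sub_le_self _ ENNReal.toReal_nonneg)).trans ?_
  exact ENNReal.ofReal_toReal_le

variable {X : Type*} [MetricSpace X]

/-- Along a curve that is continuous on a compact interval, the lower bound for the value function
is uniform. -/
theorem exists_quadratic_le {w : ℝ → X} {a b : ℝ} (hw : ContinuousOn w (Icc a b)) (ustar : X)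
    (A B : ℝ) : ∃ C : ℝ, 0 ≤ C ∧ ∀ t ∈ Icc a b, B * dist (w t) ustar ^ 2 + A ≤ C := by
  obtain ⟨C, hC⟩ := isCompact_Icc.bddAbove_image (f := fun t => B * dist (w t) ustar ^ 2 + A)
    (by fun_prop)
  exact ⟨max C 0, le_max_right _ _, fun t ht => le_max_of_le_left (hC ⟨t, ht, rfl⟩)⟩

/-- The truncation at `0` comes from `toENNReal` and saves proving `v ≤ f` at each use. -/
theorem upperSlope_eq_ofReal {φ : X → EReal} {ε : ℝ} (hε : 0 < ε) {x : X} {f v : ℝ}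
    (hf : φ x = f) (hv : valueFunction φ ε x = v) :
    upperSlope φ ε x = ENNReal.ofReal √(2 / ε * max (f - v) 0) := by
  rw [upperSlope, if_neg (by rw [hv]; exact EReal.coe_ne_top _), hf, hv, ← EReal.coe_sub,
    EReal.real_coe_toENNReal, ← ENNReal.ofReal_mul (by positivity)]
  have : ENNReal.ofReal (2 / ε * (f - v)) = ENNReal.ofReal (2 / ε * max (f - v) 0) := by
    rcases le_total 0 (f - v) with h | h
    · rw [max_eq_left h]
    · rw [max_eq_right h, mul_zero, ENNReal.ofReal_zero, ENNReal.ofReal_eq_zero]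
      exact mul_nonpos_of_nonneg_of_nonpos (by positivity) h
  rw [this, ENNReal.ofReal_rpow_of_nonneg (by positivity) (by norm_num), Real.sqrt_eq_rpow]

/-- The standing assumptions on the energy and on the parameter. -/
structure Standing (φ : X → EReal) (ustar : X) (A B ε : ℝ) : Prop
    extends Coercive φ ustar A B where
  eps_pos : 0 < ε
  le_eps : B ≤ 1 / (16 * ε)
  lsc : LowerSemicontinuous φ

theorem Standing.valueFunction_ne_bot {φ : X → EReal} {ustar : X} {A B ε : ℝ}
    (hφ : Standing φ ustar A B ε) (x : X) : valueFunction φ ε x ≠ ⊥ := fun h => by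
  have := neg_le_valueFunction hφ.toCoercive hφ.eps_pos hφ.le_eps x
  rw [h, le_bot_iff] at this
  exact EReal.coe_ne_bot _ this

theorem Standing.neg_le_toReal {φ : X → EReal} {ustar : X} {A B ε : ℝ}
    (hφ : Standing φ ustar A B ε) {x : X} (hx : valueFunction φ ε x ≠ ⊤) :
    -(B * dist x ustar ^ 2 + A) ≤ (valueFunction φ ε x).toReal := by
  have := neg_le_valueFunction hφ.toCoercive hφ.eps_pos hφ.le_eps x
  rwa [← EReal.coe_toReal hx (hφ.valueFunction_ne_bot x), EReal.coe_le_coe_iff] at this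

/-! ### The value function along energy curves -/

namespace EnergyCurve

variable {φ : X → EReal} {ustar : X} {A B ε a b : ℝ} {w : ℝ → X} {m ψ : ℝ → ℝ}

/-- Dynamic programming carries finiteness of the value backwards in time. -/
theorem ne_top_left (hφ : Standing φ ustar A B ε) (hab : a ≤ b) (h : EnergyCurve φ a b w m ψ)
    (hb : valueFunction φ ε (w b) ≠ ⊤) : valueFunction φ ε (w a) ≠ ⊤ := by
  obtain ⟨c, hc, -⟩ := EReal.lt_iff_exists_real_btwn.1 (lt_top_iff_ne_top.2 hb)
  have := h.valueFunction_le hφ.toCoercive hφ.eps_pos hφ.le_eps hab one_pos hc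
  exact ne_top_of_le_ne_top (EReal.coe_ne_top _) this

/-- At almost every time the energy is finite, and so is the value, being at most the energy.
Finiteness spreads from such a time to earlier times by dynamic programming and to later ones by
reversal. The interval must have positive length for such a time to exist. -/
theorem ne_top (hφ : Standing φ ustar A B ε) (hab : a < b) (h : EnergyCurve φ a b w m ψ)
    {t : ℝ} (ht : t ∈ Icc a b) : valueFunction φ ε (w t) ≠ ⊤ := by
  have hne : (ae (volume.restrict (Icc a b))).NeBot := by
    rw [ae_neBot]
    intro h0
    have := Measure.restrict_eq_zero.1 h0
    rw [Real.volume_Icc, ENNReal.ofReal_eq_zero] at this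
    linarith
  obtain ⟨r, hr, hrm⟩ := (h.ae_eq.and (ae_restrict_mem measurableSet_Icc)).exists
  have hr' : valueFunction φ ε (w r) ≠ ⊤ :=
    ne_top_of_le_ne_top (by rw [hr]; exact EReal.coe_ne_top _)
      (WED.valueFunction_le hφ.ne_bot hφ.eps_pos (w r))
  rcases le_total t r with htr | hrt
  · exact (h.mono (Icc_subset_Icc ht.1 hrm.2)).ne_top_left hφ htr hr'
  · have := (h.mono (Icc_subset_Icc hrm.1 ht.2)).reverse.ne_top_left hφ hrt
    simp only [add_sub_cancel_right, add_sub_cancel_left] at this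
    exact this hr'

theorem toReal_valueFunction_le (hφ : Standing φ ustar A B ε) {s t : ℝ} (hst : s ≤ t)
    (h : EnergyCurve φ s t w m ψ) (hs : valueFunction φ ε (w s) ≠ ⊤)
    (ht : valueFunction φ ε (w t) ≠ ⊤) {l : ℝ} (hl : 0 < l) :
    (valueFunction φ ε (w s)).toReal ≤
      (∫ r in s..t, (l * m r ^ 2 / 2 + ψ r / (l * ε)) * Real.exp (-(r - s) / (l * ε))) +
        Real.exp (-(t - s) / (l * ε)) * (valueFunction φ ε (w t)).toReal := by
  have hε := hφ.eps_pos
  refine le_of_forall_pos_le_add fun η hη => ?_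
  have h1 := h.valueFunction_le hφ.toCoercive hε hφ.le_eps hst hl
    (c := (valueFunction φ ε (w t)).toReal + η) (by
      conv_lhs => rw [← EReal.coe_toReal ht (hφ.valueFunction_ne_bot _)]
      rw [EReal.coe_lt_coe_iff]
      linarith)
  rw [← EReal.coe_toReal hs (hφ.valueFunction_ne_bot _), EReal.coe_le_coe_iff] at h1
  have h2 : Real.exp (-(t - s) / (l * ε)) ≤ 1 := by
    refine Real.exp_le_one_iff.2 ?_
    rw [neg_div, neg_nonpos]
    exact div_nonneg (by linarith) (by positivity)
  nlinarith

/-- The case `l = 1` with the discount factor estimated crudely: `(1 - e^{-(t-s)/ε}) (-V) ≤ C (t -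
s)/ε`. It serves only to give absolute continuity, so the constants do not matter. -/
theorem toReal_valueFunction_sub_le (hφ : Standing φ ustar A B ε) {s t : ℝ} (hst : s ≤ t)
    (h : EnergyCurve φ s t w m ψ) (hs : valueFunction φ ε (w s) ≠ ⊤)
    (ht : valueFunction φ ε (w t) ≠ ⊤) {C : ℝ} (hC : 0 ≤ C)
    (htC : -C ≤ (valueFunction φ ε (w t)).toReal) :
    (valueFunction φ ε (w s)).toReal - (valueFunction φ ε (w t)).toReal ≤
      ∫ r in s..t, (m r ^ 2 / 2 + |ψ r| / ε + C / ε) := by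
  have hε := hφ.eps_pos
  have h1 := h.toReal_valueFunction_le hφ hst hs ht one_pos
  simp only [one_mul] at h1
  have hi1 : IntegrableOn (fun r => m r ^ 2 / 2 + ψ r / ε) (Icc s t) :=
    (h.memLp.integrable_sq.div_const 2).add (h.integrable.div_const ε)
  have hi2 : IntegrableOn (fun r => m r ^ 2 / 2 + |ψ r| / ε) (Icc s t) :=
    (h.memLp.integrable_sq.div_const 2).add (h.integrable.abs.div_const ε)
  have hi1' : IntegrableOn (fun r => (m r ^ 2 / 2 + ψ r / ε) * Real.exp (-(r - s) / ε))
    (Icc s t) := hi1.mul_continuousOn (by fun_prop) isCompact_Icc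
  rw [← intervalIntegrable_iff_integrableOn_Icc_of_le hst] at hi1' hi2
  have h2 : ∫ r in s..t, (m r ^ 2 / 2 + ψ r / ε) * Real.exp (-(r - s) / ε) ≤
      ∫ r in s..t, (m r ^ 2 / 2 + |ψ r| / ε) := by
    refine intervalIntegral.integral_mono_on hst hi1' hi2 fun r hr => ?_
    have he : Real.exp (-(r - s) / ε) ≤ 1 := by
      refine Real.exp_le_one_iff.2 ?_
      rw [neg_div, neg_nonpos]
      exact div_nonneg (by linarith [hr.1]) hε.le
    have h3 : m r ^ 2 / 2 + ψ r / ε ≤ m r ^ 2 / 2 + |ψ r| / ε := by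
      gcongr; exact le_abs_self _
    have h4 : 0 ≤ m r ^ 2 / 2 + |ψ r| / ε := by positivity
    nlinarith [Real.exp_pos (-(r - s) / ε)]
  rw [intervalIntegral.integral_add hi2 (by simp), intervalIntegral.integral_const, smul_eq_mul]
  have h5 : 1 - (t - s) / ε ≤ Real.exp (-(t - s) / ε) := by
    have := Real.add_one_le_exp (-(t - s) / ε)
    rw [neg_div] at this ⊢
    linarith
  have h6 : Real.exp (-(t - s) / ε) ≤ 1 := by
    refine Real.exp_le_one_iff.2 ?_
    rw [neg_div, neg_nonpos]
    exact div_nonneg (by linarith) hε.le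
  have h7 : (t - s) * (C / ε) = (t - s) / ε * C := by ring
  rw [h7]
  nlinarith

theorem continuousOn (h : EnergyCurve φ a b w m ψ) : ContinuousOn w (Icc a b) :=
  h.acCurve.mono_exponent.continuousOn

theorem exists_integrable_bound (hφ : Standing φ ustar A B ε) (hab : a < b)
    (h : EnergyCurve φ a b w m ψ) :
    ∃ g : ℝ → ℝ, IntervalIntegrable g volume a b ∧ ∀ s ∈ Icc a b, ∀ t ∈ Icc a b, s ≤ t →
      |(valueFunction φ ε (w t)).toReal - (valueFunction φ ε (w s)).toReal| ≤
        ∫ r in s..t, g r := by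
  obtain ⟨C, hC0, hC⟩ := exists_quadratic_le h.continuousOn ustar A B
  have hlow : ∀ t ∈ Icc a b, -C ≤ (valueFunction φ ε (w t)).toReal := fun t ht =>
    (neg_le_neg (hC t ht)).trans (hφ.neg_le_toReal (h.ne_top hφ hab ht))
  refine ⟨fun r => m r ^ 2 / 2 + |ψ r| / ε + C / ε, ?_, fun s hs t ht hst => ?_⟩
  · rw [intervalIntegrable_iff_integrableOn_Icc_of_le hab.le]
    exact ((h.memLp.integrable_sq.div_const 2).add (h.integrable.abs.div_const ε)).add
      (integrable_const _)
  · have hsub := h.mono (Icc_subset_Icc hs.1 ht.2)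
    have hs' := h.ne_top hφ hab hs
    have ht' := h.ne_top hφ hab ht
    have h1 := hsub.toReal_valueFunction_sub_le hφ hst hs' ht' hC0 (hlow t ht)
    -- Reversal exchanges the end points and leaves the bounding integral unchanged.
    have h2 := hsub.reverse.toReal_valueFunction_sub_le hφ hst
      (by simpa using ht') (by simpa using hs') hC0 (by simpa using hlow s hs)
    rw [intervalIntegral.integral_comp_sub_left (fun r => m r ^ 2 / 2 + |ψ r| / ε + C / ε)] at h2
    simp only [add_sub_cancel_right, add_sub_cancel_left] at h2
    exact abs_sub_le_iff.2 ⟨h2, h1⟩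

theorem absolutelyContinuous (hφ : Standing φ ustar A B ε) (hab : a < b)
    (h : EnergyCurve φ a b w m ψ) :
    AbsolutelyContinuousOnInterval (fun t => (valueFunction φ ε (w t)).toReal) a b := by
  obtain ⟨g, hg, hg'⟩ := h.exists_integrable_bound hφ hab
  exact absolutelyContinuousOnInterval_of_abs_sub_le hab.le hg hg'

/-- The differential inequality holds off a null set for all rational `l` at once; optimizing in `l`
turns it into the Hamilton-Jacobi bound. -/
theorem ae_ofReal_neg_deriv_le (hφ : Standing φ ustar A B ε) (hab : a < b)
    (h : EnergyCurve φ a b w m ψ) :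
    ∀ᵐ t ∂(volume.restrict (Icc a b)),
      ENNReal.ofReal (-deriv (fun t => (valueFunction φ ε (w t)).toReal) t) ≤
        upperSlope φ ε (w t) * ENNReal.ofReal (m t) := by
  have hε := hφ.eps_pos
  have h1 : ∀ᵐ t ∂(volume.restrict (Icc a b)), ∀ l : ℚ, 0 < l →
      -deriv (fun t => (valueFunction φ ε (w t)).toReal) t ≤
        l * m t ^ 2 / 2 + (ψ t - (valueFunction φ ε (w t)).toReal) / (l * ε) := by
    rw [ae_all_iff]
    intro l
    by_cases hl : 0 < l
    swap
    · simp [hl]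
    have hl' : (0 : ℝ) < l := by exact_mod_cast hl
    filter_upwards [ae_neg_deriv_le hab.le hε hl' h.memLp.integrable_sq h.integrable
      (h.absolutelyContinuous hφ hab) fun s hs t ht hst =>
        (h.mono (Icc_subset_Icc hs.1 ht.2)).toReal_valueFunction_le hφ hst (h.ne_top hφ hab hs)
          (h.ne_top hφ hab ht) hl'] with t ht _ using ht
  filter_upwards [h1, h.ae_eq, ae_restrict_mem measurableSet_Icc] with t ht1 ht2 ht3
  rw [upperSlope_eq_ofReal hε ht2 (EReal.coe_toReal (h.ne_top hφ hab ht3)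
    (hφ.valueFunction_ne_bot _)).symm, mul_comm, ← ENNReal.ofReal_mul (h.nonneg t)]
  refine ENNReal.ofReal_le_ofReal (le_mul_sqrt_of_forall_rat (h.nonneg t) (by positivity)
    fun l hl => (ht1 l hl).trans ?_)
  have hl' : (0 : ℝ) < l := by exact_mod_cast hl
  have : 2 / ε * max (ψ t - (valueFunction φ ε (w t)).toReal) 0 / (2 * l) =
      max (ψ t - (valueFunction φ ε (w t)).toReal) 0 / (l * ε) := by field_simp
  rw [this]
  gcongr
  exact le_max_left _ _

theorem ofReal_sub_le (hφ : Standing φ ustar A B ε) (hab : a < b)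
    (h : EnergyCurve φ a b w m ψ) :
    ENNReal.ofReal ((valueFunction φ ε (w a)).toReal - (valueFunction φ ε (w b)).toReal) ≤
      ∫⁻ t in Icc a b, upperSlope φ ε (w t) * ENNReal.ofReal (m t) := by
  have hAC := h.absolutelyContinuous hφ hab
  rw [← neg_sub, ← hAC.integral_deriv_eq_sub, ← intervalIntegral.integral_neg,
    intervalIntegral.integral_of_le hab.le, ← integral_Icc_eq_integral_Ioc]
  refine (ofReal_integral_le_lintegral_ofReal ?_).trans
    (lintegral_mono_ae (h.ae_ofReal_neg_deriv_le hφ hab))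
  exact ((intervalIntegrable_iff_integrableOn_Icc_of_le hab.le).1
    hAC.intervalIntegrable_deriv).neg

theorem ofReal_abs_sub_le (hφ : Standing φ ustar A B ε) (hab : a < b)
    (h : EnergyCurve φ a b w m ψ) :
    ENNReal.ofReal |(valueFunction φ ε (w a)).toReal - (valueFunction φ ε (w b)).toReal| ≤
      ∫⁻ t in Icc a b, upperSlope φ ε (w t) * ENNReal.ofReal (m t) := by
  have h2 := h.reverse.ofReal_sub_le hφ hab
  rw [setLIntegral_Icc_comp_sub_left a b
    (fun t => upperSlope φ ε (w t) * ENNReal.ofReal (m t))] at h2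
  simp only [add_sub_cancel_right, add_sub_cancel_left] at h2
  rcases abs_choice ((valueFunction φ ε (w a)).toReal - (valueFunction φ ε (w b)).toReal)
    with he | he
  · rw [he]; exact h.ofReal_sub_le hφ hab
  · rw [he, neg_sub]; exact h2

end EnergyCurve

end WED

namespace WED

/-! ### Reparametrization -/

/-- `τ` need not be injective, so the preimage of `(c, d)` is not simply an interval between chosen
preimages. It lies inside one such closed interval and contains those that belong to `[c + η, d -
η]`; then `η → 0`. -/
theorem map_eq_volume_of_measure_Icc {ν : Measure ℝ} {τ : ℝ → ℝ} (hmono : Monotone τ)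
    (hsurj : Function.Surjective τ)
    (h : ∀ r r', r ≤ r' → ν (Icc r r') = ENNReal.ofReal (τ r' - τ r)) :
    ν.map τ = volume := by
  have hmeas : Measurable τ := hmono.measurable
  refine (Real.measure_ext_Ioo_rat fun c d => ?_).symm
  rw [Measure.map_apply hmeas measurableSet_Ioo, Real.volume_Ioo]
  rcases le_or_gt (d : ℝ) c with hdc | hcd
  · simp [hdc]
  obtain ⟨r, hr⟩ := hsurj c
  obtain ⟨r', hr'⟩ := hsurj d
  have hrr : r ≤ r' := (hmono.reflect_lt (by rw [hr, hr']; exact hcd)).le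
  refine le_antisymm ?_ ?_
  · have ht : Tendsto (fun η : ℝ => ENNReal.ofReal ((d - η) - (c + η))) (𝓝[>] 0)
        (𝓝 (ENNReal.ofReal (d - c))) := by
      have h1 : Continuous fun η : ℝ => ENNReal.ofReal ((d - η) - (c + η)) :=
        ENNReal.continuous_ofReal.comp (by fun_prop)
      have h2 := (h1.tendsto 0).mono_left (nhdsWithin_le_nhds (s := Ioi 0))
      simpa using h2
    refine le_of_tendsto ht ?_
    filter_upwards [self_mem_nhdsWithin] with η hη
    have hη : 0 < η := hη
    rcases lt_or_ge ((d : ℝ) - η) (c + η) with hlt | hge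
    · rw [ENNReal.ofReal_of_nonpos (by linarith)]
      exact zero_le
    obtain ⟨x, hx⟩ := hsurj (c + η)
    obtain ⟨y, hy⟩ := hsurj (d - η)
    rcases le_total x y with hxy | hyx
    · rw [← hx, ← hy, ← h x y hxy]
      refine measure_mono fun z hz => ⟨?_, ?_⟩
      · have := hmono hz.1; linarith
      · have := hmono hz.2; linarith
    · have := hmono hyx
      rw [ENNReal.ofReal_of_nonpos (by linarith)]
      exact zero_le
  · rw [← hr, ← hr', ← h r r' hrr]
    refine measure_mono fun z hz => ⟨?_, ?_⟩
    · exact (hmono.reflect_lt hz.1).le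
    · exact (hmono.reflect_lt hz.2).le

variable {X : Type*} [MetricSpace X]

/-- An absolutely continuous curve of finite weighted length can be reparametrized so that its
speed is at most the weight. -/
theorem exists_reparametrization {k : X → ℝ≥0∞} (hk : LowerSemicontinuous k) (hk1 : ∀ x, 1 ≤ k x)
    {a b : ℝ} (hab : a ≤ b) {θ : ℝ → X} (hθ : ACCurve edist 1 (Icc a b) θ)
    (hfin : ∫⁻ t in Icc a b, k (θ t) * metricDeriv edist θ t < ⊤) :
    ∃ (T : ℝ) (w : ℝ → X), 0 ≤ T ∧ Continuous w ∧ w 0 = θ a ∧ w T = θ b ∧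
      (∀ s ∈ Icc 0 T, ∀ t ∈ Icc 0 T, s ≤ t →
        edist (w s) (w t) ≤ ∫⁻ r in Icc s t, k (w r)) ∧
      ∀ F : X → ℝ≥0∞, ∫⁻ t in Icc 0 T, F (w t) * k (w t) ≤
        ∫⁻ t in Icc a b, F (θ t) * metricDeriv edist θ t := by
  set θ' : ℝ → X := clamp a b θ with hθ'
  have hc : Continuous θ' := continuous_clamp hab hθ.continuousOn
  set g := metricDeriv edist θ' with hg
  have hgm : Measurable g := measurable_metricDeriv hc
  have hgθ : ∀ x ∈ Ioo a b, g x = metricDeriv edist θ x := fun x hx => metricDeriv_clamp θ hx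
  set κ : ℝ → ℝ≥0∞ := fun x => k (θ' x) with hκ
  have hκm : Measurable κ := (hk.comp hc).measurable
  have hκ1 : ∀ x, 1 ≤ κ x := fun x => hk1 _
  have hcongr : ∀ F : X → ℝ≥0∞, ∫⁻ t in Icc a b, F (θ t) * metricDeriv edist θ t =
      ∫⁻ t in Icc a b, F (θ' t) * g t := fun F => by
    rw [← restrict_Ioo_eq_restrict_Icc]
    refine setLIntegral_congr_fun measurableSet_Ioo fun t ht => ?_
    simp only [hgθ t ht, hθ', clamp_of_mem θ (Ioo_subset_Icc_self ht)]
  rw [hcongr k] at hfin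
  -- The density of the new time is speed divided by weight. Density `1` outside the interval makes
  -- `τ` a proper surjection of the line.
  set p : ℝ → ℝ := fun x => if x ∈ Ioc a b then (g x / κ x).toReal else 1 with hp
  have hpm : Measurable p :=
    Measurable.ite measurableSet_Ioc (hgm.div hκm).ennreal_toReal measurable_const
  have hp0 : ∀ x, 0 ≤ p x := fun x => by
    simp only [hp]; split_ifs
    · exact ENNReal.toReal_nonneg
    · exact zero_le_one
  -- Finite weighted length excludes, almost everywhere, an infinite weight with positive speed as
  -- well as an infinite speed, so the quotient loses nothing.
  have hae : ∀ᵐ x ∂(volume.restrict (Icc a b)), g x = κ x * ENNReal.ofReal (p x) := by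
    have h1 := ae_lt_top (hκm.mul hgm) hfin.ne
    rw [← restrict_Ioc_eq_restrict_Icc] at h1 ⊢
    filter_upwards [h1, ae_restrict_mem measurableSet_Ioc] with x hx hxs
    simp only [hp, if_pos hxs]
    have hκ0 : κ x ≠ 0 := (zero_lt_one.trans_le (hκ1 x)).ne'
    rcases eq_or_ne (g x) 0 with h0 | h0
    · simp [h0]
    have hκt : κ x ≠ ⊤ := by
      intro ht
      simp only [Pi.mul_apply] at hx
      rw [ht, ENNReal.top_mul h0] at hx
      exact lt_irrefl _ hx
    have hgt : g x ≠ ⊤ := by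
      intro ht
      simp only [Pi.mul_apply] at hx
      rw [ht, ENNReal.mul_top hκ0] at hx
      exact lt_irrefl _ hx
    rw [ENNReal.ofReal_toReal (ENNReal.div_lt_top hgt hκ0).ne, ENNReal.mul_div_cancel hκ0 hκt]
  have hpi : ∀ s t, IntervalIntegrable p volume s t := by
    intro s t
    have h1 : IntegrableOn (fun x => (g x / κ x).toReal) (Icc a b) := by
      refine integrable_toReal_of_lintegral_ne_top (hgm.div hκm).aemeasurable
        (lt_of_le_of_lt (lintegral_mono fun x => ?_) hfin).ne
      refine (ENNReal.div_le_of_le_mul ?_ : g x / κ x ≤ g x).trans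
        (le_mul_of_one_le_left zero_le (hκ1 x))
      exact le_mul_of_one_le_right zero_le (hκ1 x)
    have h2 : p = (Ioc a b).indicator (fun x => (g x / κ x).toReal) +
        (Ioc a b)ᶜ.indicator (fun _ => (1 : ℝ)) := by
      ext x
      by_cases hx : x ∈ Ioc a b
      · simp only [hp, if_pos hx, Pi.add_apply, indicator_of_mem hx,
          indicator_of_notMem (show x ∉ (Ioc a b)ᶜ from fun h => h hx), add_zero]
      · simp only [hp, if_neg hx, Pi.add_apply, indicator_of_notMem hx,
          indicator_of_mem (show x ∈ (Ioc a b)ᶜ from hx), zero_add]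
    rw [h2]
    refine IntervalIntegrable.add ?_ ?_
    · exact ((h1.mono_set Ioc_subset_Icc_self).integrable_indicator
        measurableSet_Ioc).intervalIntegrable
    · rw [intervalIntegrable_iff]
      exact (intervalIntegrable_iff.1 intervalIntegrable_const).indicator measurableSet_Ioc.compl
  set τ : ℝ → ℝ := fun r => ∫ x in a..r, p x with hτ
  have hτsub : ∀ r r', τ r' - τ r = ∫ x in r..r', p x := fun r r' =>
    intervalIntegral.integral_interval_sub_left (hpi a r') (hpi a r)
  have hτmono : Monotone τ := fun r r' h => by
    have h1 : 0 ≤ ∫ x in r..r', p x := intervalIntegral.integral_nonneg h fun x _ => hp0 x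
    rw [← hτsub] at h1
    exact sub_nonneg.1 h1
  have hτc : Continuous τ := intervalIntegral.continuous_primitive hpi a
  have hτa : τ a = 0 := by simp [hτ]
  have hright : ∀ r, b ≤ r → τ r = τ b + (r - b) := fun r hr => by
    have h1 : ∫ x in b..r, p x = ∫ x in b..r, (1 : ℝ) := by
      refine intervalIntegral.integral_congr_ae (Eventually.of_forall fun x hx => ?_)
      rw [uIoc_of_le hr] at hx
      exact if_neg fun h => absurd h.2 (not_le.2 hx.1)
    rw [intervalIntegral.integral_const, smul_eq_mul, mul_one] at h1
    linarith [hτsub b r]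
  have hleft : ∀ r, r ≤ a → τ r = r - a := fun r hr => by
    have h1 : ∫ x in r..a, p x = ∫ x in r..a, (1 : ℝ) := by
      refine intervalIntegral.integral_congr_ae (Eventually.of_forall fun x hx => ?_)
      rw [uIoc_of_le hr] at hx
      exact if_neg fun h => absurd h.1 (not_lt.2 hx.2)
    rw [intervalIntegral.integral_const, smul_eq_mul, mul_one] at h1
    linarith [hτsub r a]
  have htop : Tendsto τ atTop atTop := by
    refine Tendsto.congr' (f₁ := fun r => τ b + (r - b)) ?_ ?_
    · filter_upwards [eventually_ge_atTop b] with r hr using (hright r hr).symm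
    · exact tendsto_atTop_add_const_left _ _ (tendsto_atTop_add_const_right _ _ tendsto_id)
  have hbot : Tendsto τ atBot atBot := by
    refine Tendsto.congr' (f₁ := fun r => r - a) ?_ ?_
    · filter_upwards [eventually_le_atBot a] with r hr using (hleft r hr).symm
    · exact tendsto_atBot_add_const_right _ _ tendsto_id
  have hsurj : Function.Surjective τ := hτc.surjective htop hbot
  -- `τ` may be constant on intervals and has no continuous inverse in general. As a proper map it
  -- is closed, hence a quotient map, and continuity of `w` can be tested on `w ∘ τ`.
  have hquot : IsQuotientMap τ := by
    refine IsClosedMap.isQuotientMap (IsProperMap.isClosedMap ?_) hτc hsurj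
    rw [isProperMap_iff_tendsto_cocompact]
    refine ⟨hτc, ?_⟩
    rw [cocompact_eq_atBot_atTop, tendsto_sup]
    exact ⟨hbot.mono_right le_sup_left, htop.mono_right le_sup_right⟩
  set ν : Measure ℝ := volume.withDensity fun x => ENNReal.ofReal (p x) with hν
  have hlν : ∀ F : ℝ → ℝ≥0∞, ∫⁻ x, F x ∂ν = ∫⁻ x, ENNReal.ofReal (p x) * F x := fun F => by
    rw [hν, lintegral_withDensity_eq_lintegral_mul_non_measurable _ (by fun_prop)
      (Eventually.of_forall fun _ => ENNReal.ofReal_lt_top)]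
    rfl
  have hpIcc : ∀ r r', r ≤ r' →
      ∫⁻ x in Icc r r', ENNReal.ofReal (p x) = ENNReal.ofReal (τ r' - τ r) := fun r r' h => by
    rw [← ofReal_integral_eq_lintegral_ofReal
      ((intervalIntegrable_iff_integrableOn_Icc_of_le h).1 (hpi r r'))
      (Eventually.of_forall fun x => hp0 x), integral_Icc_eq_integral_Ioc,
      ← intervalIntegral.integral_of_le h, hτsub]
  have hmap : ν.map τ = volume := map_eq_volume_of_measure_Icc hτmono hsurj fun r r' h => by
    rw [hν, withDensity_apply _ measurableSet_Icc, hpIcc r r' h]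
  -- Without measurability only this inequality is available; it is the direction needed for an
  -- arbitrary `F`, such as `G`, whose measurability is not known.
  have hcov_le : ∀ F : ℝ → ℝ≥0∞, ∫⁻ c, F c ≤ ∫⁻ x, ENNReal.ofReal (p x) * F (τ x) := fun F => by
    rw [← hlν (fun x => F (τ x))]
    conv_lhs => rw [← hmap]
    exact lintegral_map_le _ _
  have hcov : ∀ F : ℝ → ℝ≥0∞, Measurable F →
      ∫⁻ c, F c = ∫⁻ x, ENNReal.ofReal (p x) * F (τ x) := fun F hF => by
    rw [← hlν (fun x => F (τ x))]
    conv_lhs => rw [← hmap]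
    exact lintegral_map hF hτc.measurable
  have hkey : ∀ r r', r ≤ r' →
      edist (θ' r) (θ' r') ≤ ∫⁻ x in Icc r r', κ x * ENNReal.ofReal (p x) := by
    intro r r' hr
    set s := max a (min b r) with hs
    set s' := max a (min b r') with hs'
    have hss : s ≤ s' := by simp only [hs, hs']; gcongr
    have e1 : θ' r = θ s := rfl
    have e2 : θ' r' = θ s' := rfl
    rcases hss.eq_or_lt with h | h
    · rw [e1, e2, h]; simp
    have hs'b : s' ≤ b := max_le hab (min_le_left _ _)
    have hsa : a ≤ s := le_max_left _ _
    have hrs : r ≤ s := by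
      rcases le_total b r with hbr | hbr
      · have : b ≤ s := by rw [hs, min_eq_left hbr]; exact le_max_right _ _
        linarith
      · rw [hs, min_eq_right hbr]; exact le_max_right _ _
    have hrs' : s' ≤ r' := by
      rcases le_total (min b r') a with h1 | h1
      · have : s' = a := max_eq_left h1
        linarith
      · rw [hs', max_eq_right h1]; exact min_le_right _ _
    rw [e1, e2]
    have hsub : Icc s s' ⊆ Icc a b := Icc_subset_Icc hsa hs'b
    refine (edist_le_lintegral_metricDeriv hss (hθ.mono hsub)).trans ?_
    refine le_trans ?_ (lintegral_mono_set (Icc_subset_Icc hrs hrs'))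
    have h3 := ae_restrict_of_ae_restrict_of_subset hsub hae
    rw [← restrict_Ioo_eq_restrict_Icc] at h3 ⊢
    refine lintegral_mono_ae ?_
    filter_upwards [h3, ae_restrict_mem measurableSet_Ioo] with x hx hxs
    rw [← hx, hgθ x ⟨hsa.trans_lt hxs.1, hxs.2.trans_le hs'b⟩]
  -- Where `τ` stands still, `p` vanishes a.e. and the curve does not move. Thus `θ'` is constant on
  -- the fibres of `τ` and any choice of preimage defines the same `w`.
  have hwell' : ∀ r r', r ≤ r' → τ r = τ r' → θ' r = θ' r' := by
    intro r r' hr hτr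
    have h1 := hpIcc r r' hr
    rw [hτr, sub_self, ENNReal.ofReal_zero, lintegral_eq_zero_iff (by fun_prop)] at h1
    refine edist_eq_zero.1 (le_antisymm ((hkey r r' hr).trans (le_of_eq ?_)) zero_le)
    rw [lintegral_eq_zero_iff (by fun_prop)]
    filter_upwards [h1] with x hx
    simp only [Pi.zero_apply] at hx ⊢
    rw [hx, mul_zero]
  have hwell : ∀ r r', τ r = τ r' → θ' r = θ' r' := fun r r' h => by
    rcases le_total r r' with hr | hr
    · exact hwell' r r' hr h
    · exact (hwell' r' r hr h.symm).symm
  set w : ℝ → X := fun c => θ' (Function.surjInv hsurj c) with hw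
  have hwτ : ∀ r, w (τ r) = θ' r := fun r => hwell _ _ (Function.surjInv_eq hsurj _)
  have hwc : Continuous w := by
    rw [hquot.continuous_iff]
    exact hc.congr fun r => (hwτ r).symm
  have hmem : ∀ x, τ x ∈ Icc 0 (τ b) → x ∈ Icc a b := by
    intro x hx
    constructor
    · by_contra h
      have := hleft x (not_le.1 h).le
      linarith [hx.1, not_le.1 h]
    · by_contra h
      have := hright x (not_le.1 h).le
      linarith [hx.2, not_le.1 h]
  refine ⟨τ b, w, ?_, hwc, ?_, ?_, ?_, ?_⟩
  · rw [← hτa]; exact hτmono hab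
  · rw [← hτa, hwτ]; exact clamp_of_mem θ (left_mem_Icc.2 hab)
  · rw [hwτ]; exact clamp_of_mem θ (right_mem_Icc.2 hab)
  · intro s _ t _ hst
    obtain ⟨r, rfl⟩ := hsurj s
    obtain ⟨r', rfl⟩ := hsurj t
    rcases hst.eq_or_lt with h | h
    · rw [h]; simp
    have hr := (hτmono.reflect_lt h).le
    have hkw : Measurable fun c => k (w c) := (hk.comp hwc).measurable
    rw [hwτ, hwτ]
    refine (hkey r r' hr).trans ?_
    rw [← lintegral_indicator (measurableSet_Icc (a := τ r) (b := τ r')),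
      hcov _ (hkw.indicator measurableSet_Icc), ← lintegral_indicator measurableSet_Icc]
    refine lintegral_mono fun x => ?_
    by_cases hx : x ∈ Icc r r'
    · rw [indicator_of_mem hx,
        indicator_of_mem (show τ x ∈ Icc (τ r) (τ r') from ⟨hτmono hx.1, hτmono hx.2⟩), hwτ,
        mul_comm]
    · rw [indicator_of_notMem hx]; exact zero_le
  · intro F
    rw [hcongr F, ← lintegral_indicator (measurableSet_Icc (a := 0) (b := τ b))]
    refine (hcov_le _).trans ?_
    have h1 : ∫⁻ t in Icc a b, F (θ' t) * g t =
        ∫⁻ t in Icc a b, F (θ' t) * (κ t * ENNReal.ofReal (p t)) := by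
      refine lintegral_congr_ae ?_
      filter_upwards [hae] with x hx
      rw [← hx]
    rw [h1, ← lintegral_indicator measurableSet_Icc]
    refine lintegral_mono fun x => ?_
    by_cases hx : τ x ∈ Icc 0 (τ b)
    · rw [indicator_of_mem hx, indicator_of_mem (hmem x hx), hwτ]
      refine le_of_eq ?_
      simp only [hκ]
      ring
    · rw [indicator_of_notMem hx, mul_zero]; exact zero_le

end WED

namespace WED

variable {X : Type*}

/-! ### The weight of the Finsler distance -/

/-- The weight `(φ ∨ 1)^{1/2}` of the Finsler distance. -/
noncomputable def energyWeight (φ : X → EReal) (x : X) : ℝ≥0∞ :=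
  (max (φ x) 1).toENNReal ^ (1 / 2 : ℝ)

theorem energyWeight_sq (φ : X → EReal) (x : X) :
    energyWeight φ x ^ 2 = (max (φ x) 1).toENNReal := by
  rw [energyWeight, ← ENNReal.rpow_natCast, ← ENNReal.rpow_mul]
  norm_num

theorem one_le_energyWeight (φ : X → EReal) (x : X) : 1 ≤ energyWeight φ x := by
  refine ENNReal.one_le_rpow ?_ (by norm_num)
  refine le_trans (le_of_eq ?_) (EReal.toENNReal_le_toENNReal (le_max_right (φ x) 1))
  rw [← EReal.coe_one, EReal.real_coe_toENNReal, ENNReal.ofReal_one]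

theorem ne_top_of_energyWeight_ne_top {φ : X → EReal} {x : X} (h : energyWeight φ x ≠ ⊤) :
    φ x ≠ ⊤ := by
  intro ht
  rw [energyWeight, ht] at h
  simp at h

theorem energyWeight_toReal_sq {φ : X → EReal} {x : X} {y : ℝ} (h : φ x = y) :
    (energyWeight φ x).toReal ^ 2 = max y 1 := by
  rw [← ENNReal.toReal_pow, energyWeight_sq, h]
  have : max (y : EReal) 1 = ((max y 1 : ℝ) : EReal) := by
    rcases le_total y 1 with h | h
    · rw [max_eq_right h, max_eq_right (by exact_mod_cast h)]; rfl
    · rw [max_eq_left h, max_eq_left (by exact_mod_cast h)]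
  rw [this, EReal.real_coe_toENNReal, ENNReal.toReal_ofReal (by positivity)]

variable [MetricSpace X]

theorem lowerSemicontinuous_energyWeight {φ : X → EReal} (hφ : LowerSemicontinuous φ) :
    LowerSemicontinuous (energyWeight φ) := by
  refine Continuous.comp_lowerSemicontinuous
    (g := fun y : EReal => (max y 1).toENNReal ^ (1 / 2 : ℝ)) ?_ hφ ?_
  · exact ENNReal.continuous_rpow_const.comp
      (EReal.continuous_toENNReal.comp (continuous_id.max continuous_const))
  · exact fun x y h => ENNReal.rpow_le_rpow
      (EReal.toENNReal_le_toENNReal (max_le_max h le_rfl)) (by norm_num)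

theorem Coercive.neg_le {φ : X → EReal} {ustar : X} {A B : ℝ} (hφ : Coercive φ ustar A B)
    (x : X) : ((-(B * dist x ustar ^ 2 + A) : ℝ) : EReal) ≤ φ x := by
  have := hφ.le x x
  simpa using this

/-- With the weight as speed bound, the single condition that weight squared, `φ ∨ 1`, is integrable
yields both an `L²` speed and an integrable positive part of the energy. The negative part is
bounded along the compact curve by coercivity. -/
theorem energyCurve_of_weight {φ : X → EReal} {ustar : X} {A B ε : ℝ}
    (hφ : Standing φ ustar A B ε) {T : ℝ} {w : ℝ → X} (hw : Continuous w)
    (hd : ∀ s ∈ Icc 0 T, ∀ t ∈ Icc 0 T, s ≤ t →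
      edist (w s) (w t) ≤ ∫⁻ r in Icc s t, energyWeight φ (w r))
    (hfin : ∫⁻ t in Icc 0 T, energyWeight φ (w t) ^ 2 < ⊤) :
    EnergyCurve φ 0 T w (fun t => (energyWeight φ (w t)).toReal) fun t => (φ (w t)).toReal := by
  have hkm : Measurable fun t => energyWeight φ (w t) :=
    ((lowerSemicontinuous_energyWeight hφ.lsc).comp hw).measurable
  have hφm : Measurable fun t => φ (w t) := (hφ.lsc.comp hw).measurable
  have hae : ∀ᵐ t ∂(volume.restrict (Icc 0 T)), energyWeight φ (w t) ≠ ⊤ := by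
    filter_upwards [ae_lt_top (hkm.pow_const 2) hfin.ne] with t ht h
    rw [h] at ht
    simp at ht
  have hsq : Integrable (fun t => (energyWeight φ (w t)).toReal ^ 2)
      (volume.restrict (Icc 0 T)) := by
    have := integrable_toReal_of_lintegral_ne_top (hkm.pow_const 2).aemeasurable hfin.ne
    simpa only [ENNReal.toReal_pow] using this
  have hL : MemLp (fun t => (energyWeight φ (w t)).toReal) 2 (volume.restrict (Icc 0 T)) :=
    (memLp_two_iff_integrable_sq hkm.ennreal_toReal.aestronglyMeasurable).2 hsq
  have haeq : ∀ᵐ t ∂(volume.restrict (Icc 0 T)), φ (w t) = ((φ (w t)).toReal : EReal) := by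
    filter_upwards [hae] with t ht
    rw [EReal.coe_toReal (ne_top_of_energyWeight_ne_top ht) (hφ.ne_bot _)]
  refine ⟨fun t => ENNReal.toReal_nonneg, hL, fun s hs t ht hst => ?_, ?_, haeq⟩
  · refine (hd s hs t ht hst).trans (le_of_eq ?_)
    have hsub : Icc s t ⊆ Icc 0 T := Icc_subset_Icc hs.1 ht.2
    have hi : Integrable (fun t => (energyWeight φ (w t)).toReal) (volume.restrict (Icc s t)) :=
      (hL.mono_measure (Measure.restrict_mono hsub le_rfl)).integrable one_le_two
    rw [intervalIntegral.integral_of_le hst, ← integral_Icc_eq_integral_Ioc,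
      ofReal_integral_eq_lintegral_ofReal hi (Eventually.of_forall fun _ => ENNReal.toReal_nonneg)]
    refine lintegral_congr_ae ?_
    filter_upwards [ae_restrict_of_ae_restrict_of_subset hsub hae] with r hr
    rw [ENNReal.ofReal_toReal hr]
  · obtain ⟨C, hC0, hC⟩ := exists_quadratic_le hw.continuousOn (a := 0) (b := T) ustar A B
    refine Integrable.mono' (hsq.add (integrable_const C))
      hφm.ereal_toReal.aestronglyMeasurable ?_
    filter_upwards [haeq, ae_restrict_mem measurableSet_Icc] with t ht hts
    have h1 := hφ.neg_le (w t)
    rw [ht, EReal.coe_le_coe_iff] at h1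
    have h2 := hC t hts
    simp only [Pi.add_apply, energyWeight_toReal_sq ht, Real.norm_eq_abs]
    rw [abs_le]
    constructor
    · have := le_max_right (φ (w t)).toReal 1
      linarith
    · have := le_max_left (φ (w t)).toReal 1
      linarith

/-- The value function along an absolutely continuous curve of finite weighted length. -/
theorem valueFunction_increment_le {φ : X → EReal} {ustar : X} {A B ε : ℝ}
    (hφ : Standing φ ustar A B ε) {a b : ℝ} (hab : a ≤ b) {θ : ℝ → X}
    (hθ : ACCurve edist 1 (Icc a b) θ)
    (hfin : ∫⁻ t in Icc a b, energyWeight φ (θ t) * metricDeriv edist θ t < ⊤) :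
    θ a = θ b ∨ (valueFunction φ ε (θ a) ≠ ⊤ ∧ valueFunction φ ε (θ b) ≠ ⊤ ∧
      ENNReal.ofReal |(valueFunction φ ε (θ a)).toReal - (valueFunction φ ε (θ b)).toReal| ≤
        ∫⁻ t in Icc a b, upperSlope φ ε (θ t) * metricDeriv edist θ t) := by
  obtain ⟨T, w, hT, hw, hw0, hwT, hd, hF⟩ := exists_reparametrization
    (lowerSemicontinuous_energyWeight hφ.lsc) (one_le_energyWeight φ) hab hθ hfin
  -- New time of length zero means that the curve has not moved; nothing is then known about
  -- finiteness of the value.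
  rcases hT.eq_or_lt with rfl | hT
  · left; rw [← hw0, ← hwT]
  right
  have hE := energyCurve_of_weight hφ hw hd (by
    refine lt_of_le_of_lt (le_trans (le_of_eq ?_) (hF (energyWeight φ))) hfin
    simp only [sq])
  refine ⟨hw0 ▸ hE.ne_top hφ hT (left_mem_Icc.2 hT.le),
    hwT ▸ hE.ne_top hφ hT (right_mem_Icc.2 hT.le), ?_⟩
  have h1 := hE.ofReal_abs_sub_le hφ hT
  rw [hw0, hwT] at h1
  -- In the new time the speed bound is the weight, so `∫ G · weight` goes back to `∫ G |θ'|`.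
  refine h1.trans (le_trans (lintegral_mono fun t => ?_) (hF (upperSlope φ ε)))
  exact mul_le_mul' le_rfl ENNReal.ofReal_toReal_le

/-! ### The Finsler distance -/

theorem le_energyDist {φ : X → EReal} {x y : X} {c : ℝ≥0∞}
    (h : ∀ (a b : ℝ) (θ : ℝ → X), a ≤ b → ACCurve edist 1 (Icc a b) θ → θ a = x → θ b = y →
      c ≤ ∫⁻ t in Icc a b, energyWeight φ (θ t) * metricDeriv edist θ t) :
    c ≤ energyDist φ x y :=
  le_iInf fun a => le_iInf fun b => le_iInf fun θ => le_iInf fun hθ =>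
    h a b θ hθ.1 hθ.2.1 hθ.2.2.1 hθ.2.2.2

theorem exists_of_energyDist_lt {φ : X → EReal} {x y : X} {c : ℝ≥0∞} (h : energyDist φ x y < c) :
    ∃ (a b : ℝ) (θ : ℝ → X), a ≤ b ∧ ACCurve edist 1 (Icc a b) θ ∧ θ a = x ∧ θ b = y ∧
      ∫⁻ t in Icc a b, energyWeight φ (θ t) * metricDeriv edist θ t < c := by
  simp only [energyDist, finslerDist, iInf_lt_iff] at h
  obtain ⟨a, b, θ, hθ, hlt⟩ := h
  exact ⟨a, b, θ, hθ.1, hθ.2.1, hθ.2.2.1, hθ.2.2.2, hlt⟩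

theorem edist_le_lintegral_weight {φ : X → EReal} {a b : ℝ} {θ : ℝ → X}
    (hθ : ACCurve edist 1 (Icc a b) θ) {s t : ℝ} (has : a ≤ s) (hst : s ≤ t) (htb : t ≤ b) :
    edist (θ s) (θ t) ≤ ∫⁻ r in Icc a b, energyWeight φ (θ r) * metricDeriv edist θ r := by
  have hsub : Icc s t ⊆ Icc a b := Icc_subset_Icc has htb
  refine (edist_le_lintegral_metricDeriv hst (hθ.mono hsub)).trans
    ((lintegral_mono_set hsub).trans (lintegral_mono fun r => ?_))
  exact le_mul_of_one_le_left zero_le (one_le_energyWeight φ _)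

/-- A connecting curve either reaches distance `ρ` from `x`, which costs at least `ρ` since the
weight is at least `1`, or it stays where the weight is at least `c` and costs at least `c` times
the distance. -/
theorem min_le_energyDist_left {φ : X → EReal} {x y : X} {ρ c : ℝ≥0∞}
    (h : ∀ z, edist z x < ρ → c ≤ energyWeight φ z) :
    min ρ (c * edist x y) ≤ energyDist φ x y := by
  refine le_energyDist fun a b θ hab hθ hx hy => ?_
  by_cases hex : ∃ t ∈ Icc a b, ρ ≤ edist (θ t) x
  · obtain ⟨t, ht, htρ⟩ := hex
    refine (min_le_left _ _).trans (htρ.trans ?_)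
    rw [edist_comm, ← hx]
    exact edist_le_lintegral_weight hθ le_rfl ht.1 ht.2
  · push Not at hex
    refine (min_le_right _ _).trans ?_
    rw [← hx, ← hy]
    refine (mul_le_mul' le_rfl (edist_le_lintegral_metricDeriv hab hθ)).trans
      ((lintegral_const_mul_le _ _).trans ?_)
    exact setLIntegral_mono' measurableSet_Icc fun t ht => mul_le_mul' (h _ (hex t ht)) le_rfl

theorem min_le_energyDist_right {φ : X → EReal} {x y : X} {ρ c : ℝ≥0∞}
    (h : ∀ z, edist z y < ρ → c ≤ energyWeight φ z) :
    min ρ (c * edist x y) ≤ energyDist φ x y := by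
  refine le_energyDist fun a b θ hab hθ hx hy => ?_
  by_cases hex : ∃ t ∈ Icc a b, ρ ≤ edist (θ t) y
  · obtain ⟨t, ht, htρ⟩ := hex
    refine (min_le_left _ _).trans (htρ.trans ?_)
    rw [← hy]
    exact edist_le_lintegral_weight hθ ht.1 ht.2 le_rfl
  · push Not at hex
    refine (min_le_right _ _).trans ?_
    rw [← hx, ← hy]
    refine (mul_le_mul' le_rfl (edist_le_lintegral_metricDeriv hab hθ)).trans
      ((lintegral_const_mul_le _ _).trans ?_)
    exact setLIntegral_mono' measurableSet_Icc fun t ht => mul_le_mul' (h _ (hex t ht)) le_rfl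

theorem edist_le_energyDist (φ : X → EReal) (x y : X) : edist x y ≤ energyDist φ x y := by
  have := min_le_energyDist_left (φ := φ) (x := x) (y := y) (ρ := ⊤) (c := 1)
    fun z _ => one_le_energyWeight φ z
  simpa using this

/-- The weight times the metric speed is bounded by the speed for the Finsler distance. -/
theorem ae_energyWeight_mul_metricDeriv_le {φ : X → EReal} (hφ : LowerSemicontinuous φ) {a b : ℝ}
    (hab : a ≤ b) {u : ℝ → X} {m : ℝ → ℝ} (hm : IntervalIntegrable m volume a b)
    (h : ∀ s ∈ Icc a b, ∀ t ∈ Icc a b, s ≤ t →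
      energyDist φ (u s) (u t) ≤ ENNReal.ofReal (∫ r in s..t, m r)) :
    ∀ᵐ t ∂(volume.restrict (Icc a b)),
      energyWeight φ (u t) * metricDeriv edist u t ≤ ENNReal.ofReal |m t| := by
  rw [← restrict_Ioo_eq_restrict_Icc, ae_restrict_iff' measurableSet_Ioo]
  filter_upwards [hm.ae_hasDerivAt_integral] with t ht hts
  have hts' := Ioo_subset_Icc_self hts
  rw [uIcc_of_le hab] at ht
  have hd := ht hts' a (left_mem_Icc.2 hab)
  have hi : ∀ s ∈ Icc a b, IntervalIntegrable m volume a s := fun s hs =>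
    hm.mono_set (by rw [uIcc_of_le hs.1, uIcc_of_le hab]; exact Icc_subset_Icc le_rfl hs.2)
  set F : ℝ → ℝ := fun s => ∫ r in a..s, m r with hF
  -- A constant `c` below the weight is finite, so it can be moved inside the upper limit, and by
  -- lower semicontinuity it bounds the weight below on a whole ball.
  refine ENNReal.mul_le_of_forall_lt fun c hc d hdlt => ?_
  refine (mul_le_mul' le_rfl hdlt.le).trans ?_
  unfold metricDeriv
  rw [← ENNReal.limsup_const_mul_of_ne_top (hc.trans_le le_top).ne]
  simp only [← mul_div_assoc]
  refine limsup_div_abs_le hd ?_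
  have hev := lowerSemicontinuous_energyWeight hφ (u t) c hc
  obtain ⟨ρ, hρ, hball⟩ := EMetric.mem_nhds_iff.1 hev
  -- For `s` close to `t` the Finsler distance is below `ρ`, which rules out the first alternative
  -- in the minimum.
  have hsmall : ∀ᶠ s in 𝓝[≠] t, ENNReal.ofReal |F s - F t| < ρ := by
    have h1 : Tendsto (fun s => ENNReal.ofReal |F s - F t|) (𝓝[≠] t) (𝓝 0) := by
      have h2 : Tendsto (fun s => |F s - F t|) (𝓝 t) (𝓝 |F t - F t|) :=
        (hd.continuousAt.tendsto.sub_const _).abs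
      have h3 := ENNReal.tendsto_ofReal h2
      simp only [sub_self, abs_zero, ENNReal.ofReal_zero] at h3
      exact h3.mono_left nhdsWithin_le_nhds
    exact h1.eventually_lt_const hρ
  filter_upwards [nhdsWithin_le_nhds (Icc_mem_nhds hts.1 hts.2), hsmall] with s hs hsρ
  have hFst : ∀ s ∈ Icc a b, ∀ t ∈ Icc a b, ∫ r in s..t, m r = F t - F s := fun s hs t ht =>
    (intervalIntegral.integral_interval_sub_left (hi t ht) (hi s hs)).symm
  rcases le_total s t with hst | hst
  · have h1 := h s hs t hts' hst
    rw [hFst s hs t hts'] at h1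
    have h2 := (min_le_energyDist_right (x := u s) (fun z hz => (hball hz).le)).trans
      (h1.trans (ENNReal.ofReal_le_ofReal (le_abs_self _)))
    rw [abs_sub_comm] at h2
    exact (min_le_iff.1 h2).resolve_left (not_le.2 hsρ)
  · have h1 := h t hts' s hs hst
    rw [hFst t hts' s hs] at h1
    have h2 := (min_le_energyDist_left (y := u s) (fun z hz => (hball hz).le)).trans
      (h1.trans (ENNReal.ofReal_le_ofReal (le_abs_self _)))
    rw [edist_comm]
    exact (min_le_iff.1 h2).resolve_left (not_le.2 hsρ)

/-- `φ - V ≤ φ + C ≤ (1 + C)(φ ∨ 1)`. This comparison makes integrals of `G |u'|` finite along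
curves of finite weighted length. -/
theorem upperSlope_le {φ : X → EReal} {ε : ℝ} (hε : 0 < ε) (hbot : ∀ x, φ x ≠ ⊥) {C : ℝ}
    (hC : 0 ≤ C) {x : X} (hx : ((-C : ℝ) : EReal) ≤ valueFunction φ ε x) :
    upperSlope φ ε x ≤ ENNReal.ofReal √(2 / ε * (1 + C)) * energyWeight φ x := by
  have hK : 0 < √(2 / ε * (1 + C)) := by positivity
  rcases eq_or_ne (energyWeight φ x) ⊤ with ht | ht
  · rw [ht, ENNReal.mul_top (by simpa using hK)]
    exact le_top
  have hφt := ne_top_of_energyWeight_ne_top ht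
  have hVt : valueFunction φ ε x ≠ ⊤ := ne_top_of_le_ne_top hφt (valueFunction_le hbot hε x)
  have hVb : valueFunction φ ε x ≠ ⊥ := fun h => by
    rw [h, le_bot_iff] at hx
    exact EReal.coe_ne_bot _ hx
  rw [← EReal.coe_toReal hVt hVb, EReal.coe_le_coe_iff] at hx
  have hφe := (EReal.coe_toReal hφt (hbot x)).symm
  rw [upperSlope_eq_ofReal hε hφe (EReal.coe_toReal hVt hVb).symm, ← ENNReal.ofReal_toReal ht,
    ← ENNReal.ofReal_mul hK.le]
  refine ENNReal.ofReal_le_ofReal (Real.sqrt_le_iff.2 ⟨by positivity, ?_⟩)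
  rw [mul_pow, Real.sq_sqrt (by positivity), energyWeight_toReal_sq hφe, mul_assoc]
  refine mul_le_mul_of_nonneg_left ?_ (by positivity)
  have h1 := le_max_left (φ x).toReal 1
  have h2 := le_max_right (φ x).toReal 1
  refine max_le ?_ (by positivity)
  nlinarith

end WED

namespace WED

variable {X : Type*} [MetricSpace X]

/-! ### Continuity of the value function for the Finsler distance -/

section

variable {φ : X → EReal} {ustar : X} {A B ε : ℝ}

/-- A point of infinite value is therefore at infinite Finsler distance from every other point. -/
theorem Standing.ne_top_of_energyDist_lt_top (hφ : Standing φ ustar A B ε) {x y : X}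
    (hxy : x ≠ y) (h : energyDist φ x y < ⊤) :
    valueFunction φ ε x ≠ ⊤ ∧ valueFunction φ ε y ≠ ⊤ := by
  obtain ⟨a, b, θ, hab, hθ, rfl, rfl, hlt⟩ := exists_of_energyDist_lt h
  rcases valueFunction_increment_le hφ hab hθ hlt with h1 | h1
  · exact absurd h1 hxy
  · exact ⟨h1.1, h1.2.1⟩

/-- The value function is locally Lipschitz for the Finsler distance. -/
theorem Standing.exists_lipschitz (hφ : Standing φ ustar A B ε) (y : X) :
    ∃ K : ℝ≥0∞, K ≠ ⊤ ∧ ∀ x, x ≠ y → energyDist φ x y < 1 →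
      ENNReal.ofReal |(valueFunction φ ε x).toReal - (valueFunction φ ε y).toReal| ≤
        K * energyDist φ x y := by
  have hA := hφ.A_nonneg
  have hB := hφ.B_nonneg
  have hε := hφ.eps_pos
  set C := B * (dist y ustar + 1) ^ 2 + A with hC
  have hC0 : 0 ≤ C := by positivity
  have hK0 : 0 < √(2 / ε * (1 + C)) := by positivity
  set K := ENNReal.ofReal √(2 / ε * (1 + C)) with hK
  have hKne : K ≠ 0 := by simpa [hK] using hK0
  refine ⟨K, ENNReal.ofReal_ne_top, fun x hxy hlt => ?_⟩
  set D := ENNReal.ofReal |(valueFunction φ ε x).toReal - (valueFunction φ ε y).toReal| with hD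
  -- Only curves of weighted length below `1` matter. They stay within metric distance `1` of `y`,
  -- where `-C` bounds the value from below uniformly.
  have hmin : min 1 (D / K) ≤ energyDist φ x y := by
    refine le_energyDist fun a b θ hab hθ hx hy => ?_
    rcases le_or_gt 1 (∫⁻ t in Icc a b, energyWeight φ (θ t) * metricDeriv edist θ t) with h1 | h1
    · exact (min_le_left _ _).trans h1
    refine (min_le_right _ _).trans (ENNReal.div_le_of_le_mul ?_)
    have hinc := (valueFunction_increment_le hφ hab hθ (h1.trans ENNReal.one_lt_top)).resolve_left
      (by rwa [hx, hy])
    rw [hx, hy] at hinc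
    refine hinc.2.2.trans ?_
    rw [mul_comm, ← lintegral_const_mul' _ _ ENNReal.ofReal_ne_top]
    refine setLIntegral_mono' measurableSet_Icc fun t ht => ?_
    rw [← mul_assoc]
    refine mul_le_mul' (upperSlope_le hε hφ.ne_bot hC0 (le_trans ?_
      (neg_le_valueFunction hφ.toCoercive hε hφ.le_eps (θ t)))) le_rfl
    rw [EReal.coe_le_coe_iff]
    have h2 := (edist_le_lintegral_weight hθ ht.1 ht.2 le_rfl).trans h1.le
    rw [hy, edist_dist, ENNReal.ofReal_le_one] at h2
    have h3 : dist (θ t) ustar ≤ dist y ustar + 1 := by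
      linarith [dist_triangle (θ t) y ustar]
    have h4 : dist (θ t) ustar ^ 2 ≤ (dist y ustar + 1) ^ 2 :=
      pow_le_pow_left₀ dist_nonneg h3 2
    have h5 := mul_le_mul_of_nonneg_left h4 hB
    linarith
  have h2 := (min_le_iff.1 hmin).resolve_left (not_le.2 hlt)
  rwa [ENNReal.div_le_iff hKne ENNReal.ofReal_ne_top, mul_comm] at h2

/-- If `V y = ∞`, then `y` is isolated for `d_φ` and the sequence is eventually constant. Otherwise
the values are eventually finite and the local Lipschitz bound applies. -/
theorem Standing.tendsto_valueFunction (hφ : Standing φ ustar A B ε) {x : ℕ → X} {y : X}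
    (h : Tendsto (fun n => energyDist φ (x n) y) atTop (𝓝 0)) :
    Tendsto (fun n => valueFunction φ ε (x n)) atTop (𝓝 (valueFunction φ ε y)) := by
  have hev : ∀ᶠ n in atTop, energyDist φ (x n) y < 1 := h.eventually_lt_const one_pos
  by_cases hy : valueFunction φ ε y = ⊤
  · refine tendsto_const_nhds.congr' ?_
    filter_upwards [hev] with n hn
    by_contra hne
    exact (hφ.ne_top_of_energyDist_lt_top (fun he => hne (by rw [he]))
      (hn.trans ENNReal.one_lt_top)).2 hy
  obtain ⟨K, hK, hlip⟩ := hφ.exists_lipschitz y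
  have hne : ∀ᶠ n in atTop, valueFunction φ ε (x n) ≠ ⊤ := by
    filter_upwards [hev] with n hn
    by_cases he : x n = y
    · rwa [he]
    · exact (hφ.ne_top_of_energyDist_lt_top he (hn.trans ENNReal.one_lt_top)).1
  have hreal : Tendsto (fun n => (valueFunction φ ε (x n)).toReal) atTop
      (𝓝 (valueFunction φ ε y).toReal) := by
    rw [tendsto_iff_edist_tendsto_0]
    have h0 : Tendsto (fun n => K * energyDist φ (x n) y) atTop (𝓝 0) := by
      simpa using ENNReal.Tendsto.const_mul h (Or.inr hK)
    refine tendsto_of_tendsto_of_tendsto_of_le_of_le' tendsto_const_nhds h0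
      (Eventually.of_forall fun _ => zero_le) ?_
    filter_upwards [hev] with n hn
    rw [edist_dist, Real.dist_eq]
    by_cases he : x n = y
    · simp [he]
    · exact hlip _ he hn
  rw [← EReal.coe_toReal hy (hφ.valueFunction_ne_bot y)]
  refine (((continuous_coe_real_ereal.tendsto _).comp hreal)).congr' ?_
  filter_upwards [hne] with n hn
  exact EReal.coe_toReal hn (hφ.valueFunction_ne_bot _)

/-! ### The value function along absolutely continuous curves for the Finsler distance -/

/-- This brings `d_φ`-absolutely continuous curves within reach of the reparametrization, which is
stated for the metric `d`. -/
theorem lintegral_energyWeight_lt_top (hφ : LowerSemicontinuous φ) {a b : ℝ} {u : ℝ → X}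
    (hu : ACCurve (energyDist φ) 1 (Icc a b) u) :
    ∫⁻ t in Icc a b, energyWeight φ (u t) * metricDeriv edist u t < ⊤ := by
  rcases lt_or_ge b a with hab | hab
  · simp [Icc_eq_empty_of_lt hab]
  obtain ⟨m, hm, h⟩ := hu
  have hmi := ACCurve.intervalIntegrable le_rfl subset_rfl hab hm
  refine lt_of_le_of_lt (lintegral_mono_ae (ae_energyWeight_mul_metricDeriv_le hφ hab hmi h)) ?_
  exact (memLp_one_iff_integrable.1 hm).abs.lintegral_lt_top

theorem Standing.increment_le (hφ : Standing φ ustar A B ε) {a b : ℝ} (hab : a ≤ b) {u : ℝ → X}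
    (hu : ACCurve (energyDist φ) 1 (Icc a b) u) :
    u a = u b ∨ (valueFunction φ ε (u a) ≠ ⊤ ∧ valueFunction φ ε (u b) ≠ ⊤ ∧
      ENNReal.ofReal |(valueFunction φ ε (u a)).toReal - (valueFunction φ ε (u b)).toReal| ≤
        ∫⁻ t in Icc a b, upperSlope φ ε (u t) * metricDeriv edist u t) :=
  valueFunction_increment_le hφ hab (hu.mono_dist (edist_le_energyDist φ))
    (lintegral_energyWeight_lt_top hφ.lsc hu)

theorem Standing.eq_of_eq_top (hφ : Standing φ ustar A B ε) {I : Set ℝ} (hI : I.OrdConnected)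
    {u : ℝ → X} (hu : ACCurve (energyDist φ) 1 I u) {s : ℝ} (hs : s ∈ I)
    (hV : valueFunction φ ε (u s) = ⊤) {t : ℝ} (ht : t ∈ I) : u t = u s := by
  rcases le_total s t with hst | hst
  · rcases hφ.increment_le hst (hu.mono (hI.out hs ht)) with h | h
    · exact h.symm
    · exact absurd hV h.1
  · rcases hφ.increment_le hst (hu.mono (hI.out ht hs)) with h | h
    · exact h
    · exact absurd hV h.2.1

theorem Standing.ofReal_abs_sub_le (hφ : Standing φ ustar A B ε) {a b : ℝ} (hab : a ≤ b)
    {u : ℝ → X} (hu : ACCurve (energyDist φ) 1 (Icc a b) u) :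
    ENNReal.ofReal |(valueFunction φ ε (u b)).toReal - (valueFunction φ ε (u a)).toReal| ≤
        ∫⁻ t in Icc a b, upperSlope φ ε (u t) * metricDeriv edist u t := by
  rcases hφ.increment_le hab hu with h | h
  · simp [h]
  · rw [abs_sub_comm]; exact h.2.2

/-- `G` is at most a constant times the weight along the compact curve, and weight times speed is at
most `|m|`; the resulting majorant is integrable. -/
theorem Standing.exists_ae_le (hφ : Standing φ ustar A B ε) {a b : ℝ} (hab : a ≤ b)
    {u : ℝ → X} (hu : ACCurve (energyDist φ) 1 (Icc a b) u) :
    ∃ g : ℝ → ℝ, IntervalIntegrable g volume a b ∧ (∀ t, 0 ≤ g t) ∧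
      ∀ᵐ t ∂(volume.restrict (Icc a b)),
        upperSlope φ ε (u t) * metricDeriv edist u t ≤ ENNReal.ofReal (g t) := by
  have hε := hφ.eps_pos
  have huc : ContinuousOn u (Icc a b) := (hu.mono_dist (edist_le_energyDist φ)).continuousOn
  obtain ⟨C, hC0, hC⟩ := exists_quadratic_le huc ustar A B
  obtain ⟨m, hm, h⟩ := hu
  have hmi := ACCurve.intervalIntegrable le_rfl subset_rfl hab hm
  refine ⟨fun t => √(2 / ε * (1 + C)) * |m t|, hmi.abs.const_mul _, fun t => by positivity, ?_⟩
  filter_upwards [ae_energyWeight_mul_metricDeriv_le hφ.lsc hab hmi h,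
    ae_restrict_mem measurableSet_Icc] with t ht hts
  rw [ENNReal.ofReal_mul (Real.sqrt_nonneg _)]
  refine le_trans ?_ (mul_le_mul' le_rfl ht)
  rw [← mul_assoc]
  refine mul_le_mul' (upperSlope_le hε hφ.ne_bot hC0 (le_trans ?_
    (neg_le_valueFunction hφ.toCoercive hε hφ.le_eps (u t)))) le_rfl
  rw [EReal.coe_le_coe_iff]
  exact neg_le_neg (hC t hts)

/-- Passing from a bound by a lower integral to a bound by an interval integral. -/
theorem abs_le_intervalIntegral {x s t a b : ℝ} {H : ℝ → ℝ≥0∞} {g : ℝ → ℝ} (hs : s ∈ Icc a b)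
    (ht : t ∈ Icc a b) (hst : s ≤ t) (hg : IntervalIntegrable g volume a b) (hg0 : ∀ t, 0 ≤ g t)
    (hH : ∀ᵐ t ∂(volume.restrict (Icc a b)), H t ≤ ENNReal.ofReal (g t))
    (h : ENNReal.ofReal |x| ≤ ∫⁻ r in Icc s t, H r) : |x| ≤ ∫ r in s..t, g r := by
  have hsub : Icc s t ⊆ Icc a b := Icc_subset_Icc hs.1 ht.2
  have hgi : IntegrableOn g (Icc s t) :=
    ((intervalIntegrable_iff_integrableOn_Icc_of_le (hs.1.trans hs.2)).1 hg).mono_set hsub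
  have h1 := h.trans (lintegral_mono_ae (ae_restrict_of_ae_restrict_of_subset hsub hH))
  rw [← ofReal_integral_eq_lintegral_ofReal hgi (Eventually.of_forall hg0),
    integral_Icc_eq_integral_Ioc, ← intervalIntegral.integral_of_le hst] at h1
  exact (ENNReal.ofReal_le_ofReal_iff (intervalIntegral.integral_nonneg hst fun _ _ => hg0 _)).1 h1

theorem Standing.absolutelyContinuous_comp (hφ : Standing φ ustar A B ε) {a b : ℝ} (hab : a ≤ b)
    {u : ℝ → X} (hu : ACCurve (energyDist φ) 1 (Icc a b) u) :
    AbsolutelyContinuousOnInterval (fun t => (valueFunction φ ε (u t)).toReal) a b := by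
  obtain ⟨g, hg, hg0, hle⟩ := hφ.exists_ae_le hab hu
  exact absolutelyContinuousOnInterval_of_abs_sub_le hab hg fun s hs t ht hst =>
    abs_le_intervalIntegral hs ht hst hg hg0 hle
      (hφ.ofReal_abs_sub_le hst (hu.mono (Icc_subset_Icc hs.1 ht.2)))

/-- Borel measurability is available along the curve: `φ ∘ u` is lower semicontinuous and `V ∘ u` is
continuous. Nothing is claimed for `G` on all of `X`. -/
theorem measurable_upperSlope_comp (hφ : LowerSemicontinuous φ) {I : Set ℝ} {u : ℝ → X}
    (hu : ContinuousOn u I)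
    (hW : ContinuousOn (fun t => (valueFunction φ ε (u t)).toReal) I)
    (hbot : ∀ t ∈ I, valueFunction φ ε (u t) ≠ ⊥) (htop : ∀ t ∈ I, valueFunction φ ε (u t) ≠ ⊤) :
    Measurable fun t : I => upperSlope φ ε (u t) := by
  have h1 : Measurable fun t : I => φ (u t) := (hφ.comp hu.domRestrict).measurable
  have h2 : Measurable fun t : I => valueFunction φ ε (u t) := by
    have h3 : Measurable fun t : I => (((valueFunction φ ε (u t)).toReal : ℝ) : EReal) :=
      measurable_coe_real_ereal.comp hW.domRestrict.measurable
    convert h3 using 2 with t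
    exact (EReal.coe_toReal (htop t t.2) (hbot t t.2)).symm
  have h4 : (fun t : I => upperSlope φ ε (u t)) = fun t : I =>
      (ENNReal.ofReal (2 / ε) * (φ (u t) + -valueFunction φ ε (u t)).toENNReal) ^ (1 / 2 : ℝ) := by
    ext t
    rw [upperSlope, if_neg (htop t t.2), sub_eq_add_neg]
  rw [h4]
  have h5 : Measurable fun t : I => (φ (u t) + -valueFunction φ ε (u t)).toENNReal :=
    (h1.add h2.neg).ereal_toENNReal
  fun_prop

theorem continuousOn_of_forall_Icc {Y : Type*} [TopologicalSpace Y] {f : ℝ → Y} {I : Set ℝ}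
    (h : ∀ s ∈ I, ∀ t ∈ I, s ≤ t → ContinuousOn f (Icc s t)) : ContinuousOn f I := by
  intro t ht
  have hl : ContinuousWithinAt f (I ∩ Iic t) t := by
    by_cases hex : ∃ s ∈ I, s < t
    · obtain ⟨s, hs, hst⟩ := hex
      refine (h s hs t ht hst.le t (right_mem_Icc.2 hst.le)).mono_of_mem_nhdsWithin ?_
      filter_upwards [self_mem_nhdsWithin, nhdsWithin_le_nhds (Ioi_mem_nhds hst)] with r hr hr'
      exact ⟨le_of_lt hr', hr.2⟩
    · push Not at hex
      refine (continuousWithinAt_singleton).mono fun r hr => le_antisymm hr.2 (hex r hr.1)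
  have hr : ContinuousWithinAt f (I ∩ Ici t) t := by
    by_cases hex : ∃ s ∈ I, t < s
    · obtain ⟨s, hs, hst⟩ := hex
      refine (h t ht s hs hst.le t (left_mem_Icc.2 hst.le)).mono_of_mem_nhdsWithin ?_
      filter_upwards [self_mem_nhdsWithin, nhdsWithin_le_nhds (Iio_mem_nhds hst)] with r hr hr'
      exact ⟨hr.2, le_of_lt hr'⟩
    · push Not at hex
      refine (continuousWithinAt_singleton).mono fun r hr => le_antisymm (hex r hr.1) hr.2
  refine (hl.union hr).mono fun r hrI => ?_
  rcases le_total r t with h | h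
  · exact Or.inl ⟨hrI, h⟩
  · exact Or.inr ⟨hrI, h⟩

theorem Standing.measurable_upperSlope (hφ : Standing φ ustar A B ε) {I : Set ℝ}
    (hI : I.OrdConnected) {u : ℝ → X} (hu : ACCurve (energyDist φ) 1 I u) :
    Measurable fun t : I => upperSlope φ ε (u t) := by
  by_cases hex : ∃ s ∈ I, valueFunction φ ε (u s) = ⊤
  · obtain ⟨s, hs, hV⟩ := hex
    have : (fun t : I => upperSlope φ ε (u t)) = fun _ => upperSlope φ ε (u s) := by
      ext t
      rw [hφ.eq_of_eq_top hI hu hs hV t.2]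
    rw [this]
    exact measurable_const
  · push Not at hex
    refine measurable_upperSlope_comp hφ.lsc
      (continuousOn_of_forall_Icc fun s hs t ht _ =>
        ((hu.mono (hI.out hs ht)).mono_dist (edist_le_energyDist φ)).continuousOn)
      (continuousOn_of_forall_Icc fun s hs t ht hst => ?_)
      (fun t _ => hφ.valueFunction_ne_bot _) hex
    have := (hφ.absolutelyContinuous_comp hst (hu.mono (hI.out hs ht))).continuousOn
    rwa [uIcc_of_le hst] at this

/-- The increment bound holds on every subinterval with the same integrand, so Lebesgue
differentiation makes it pointwise. Measurability of `G ∘ u` is what allows the lower integral to be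
replaced by a Lebesgue integral. -/
theorem Standing.ae_deriv_le (hφ : Standing φ ustar A B ε) {a b : ℝ} (hab : a ≤ b)
    {u : ℝ → X} (hu : ACCurve (energyDist φ) 1 (Icc a b) u) :
    ∀ᵐ t ∂(volume.restrict (Icc a b)),
      DifferentiableAt ℝ (fun r => (valueFunction φ ε (u r)).toReal) t ∧
      ENNReal.ofReal |deriv (fun r => (valueFunction φ ε (u r)).toReal) t| ≤
        upperSlope φ ε (u t) * metricDeriv edist u t := by
  set W : ℝ → ℝ := fun r => (valueFunction φ ε (u r)).toReal with hW
  set H : ℝ → ℝ≥0∞ := fun t => upperSlope φ ε (u t) * metricDeriv edist u t with hH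
  have hAC : AbsolutelyContinuousOnInterval W a b := hφ.absolutelyContinuous_comp hab hu
  have hHm : AEMeasurable H (volume.restrict (Icc a b)) :=
    (aemeasurable_restrict_of_measurable_subtype measurableSet_Icc
      (hφ.measurable_upperSlope ordConnected_Icc hu)).mul
      (aemeasurable_metricDeriv_Icc (hu.mono_dist (edist_le_energyDist φ)).continuousOn)
  obtain ⟨g, hg, hg0, hle⟩ := hφ.exists_ae_le hab hu
  have hHfin : ∫⁻ t in Icc a b, H t ≠ ⊤ :=
    ((lintegral_mono_ae hle).trans_lt
      ((intervalIntegrable_iff_integrableOn_Icc_of_le hab).1 hg).lintegral_lt_top).ne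
  have hHi : IntervalIntegrable (fun t => (H t).toReal) volume a b :=
    (intervalIntegrable_iff_integrableOn_Icc_of_le hab).2
      (integrable_toReal_of_lintegral_ne_top hHm hHfin)
  have hHt : ∀ᵐ t ∂(volume.restrict (Icc a b)), H t = ENNReal.ofReal (H t).toReal := by
    filter_upwards [hle] with t ht
    rw [ENNReal.ofReal_toReal (ht.trans_lt ENNReal.ofReal_lt_top).ne]
  -- `V ∘ u` is treated as a curve in `ℝ`, whose metric derivative dominates the absolute value of
  -- its derivative.
  have hmd := ae_metricDeriv_le (δ := edist) edist_comm hab (u := W) hHi fun s hs t ht hst => by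
    rw [edist_comm, edist_dist, Real.dist_eq]
    exact ENNReal.ofReal_le_ofReal (abs_le_intervalIntegral hs ht hst hHi
      (fun _ => ENNReal.toReal_nonneg) (hHt.mono fun _ h => h.le)
      (hφ.ofReal_abs_sub_le hst (hu.mono (Icc_subset_Icc hs.1 ht.2))))
  filter_upwards [hmd, hHt, ae_restrict_mem measurableSet_Icc,
    ae_restrict_of_ae hAC.ae_differentiableAt] with t h1 h2 hts h3
  rw [uIcc_of_le hab] at h3
  refine ⟨h3 hts, (ofReal_abs_deriv_le_metricDeriv (u := W) (h3 hts)
    (Eventually.of_forall fun s => le_rfl)).trans (h1.trans (le_of_eq ?_))⟩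
  rw [abs_of_nonneg ENNReal.toReal_nonneg]
  exact h2.symm

theorem coe_le_coe_add_of_ofReal_abs_sub_le {x y : ℝ} {D : ℝ≥0∞}
    (h : ENNReal.ofReal |x - y| ≤ D) : (x : EReal) ≤ y + D := by
  have h1 : ((x - y : ℝ) : EReal) ≤ (D : EReal) := by
    refine le_trans ?_ (EReal.coe_ennreal_le_coe_ennreal_iff.2 h)
    rw [EReal.coe_ennreal_ofReal, EReal.coe_le_coe_iff]
    exact (le_abs_self _).trans (le_max_left _ _)
  calc (x : EReal) = y + ((x - y : ℝ) : EReal) := by rw [← EReal.coe_add]; congr 1; ring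
    _ ≤ y + D := add_le_add le_rfl h1

theorem Standing.isStrongUpperGradient (hφ : Standing φ ustar A B ε) :
    IsStrongUpperGradient (energyDist φ) (valueFunction φ ε) (upperSlope φ ε) := by
  intro I hI u hu
  refine ⟨hφ.measurable_upperSlope hI hu, fun s hs t ht hst => ?_⟩
  rcases hφ.increment_le hst (hu.mono (hI.out hs ht)) with h | ⟨h1, h2, h3⟩
  · rw [h]
    exact ⟨le_add_of_nonneg_right (EReal.coe_ennreal_nonneg _),
      le_add_of_nonneg_right (EReal.coe_ennreal_nonneg _)⟩
  -- The increment bound has the metric speed for `d`; since `d ≤ d_φ`, the Finsler speed is larger.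
  · have h4 := h3.trans (lintegral_mono fun r =>
      mul_le_mul' le_rfl (metricDeriv_mono (edist_le_energyDist φ) u r))
    have h5 := h4
    rw [abs_sub_comm] at h5
    rw [← EReal.coe_toReal h1 (hφ.valueFunction_ne_bot _),
      ← EReal.coe_toReal h2 (hφ.valueFunction_ne_bot _)]
    exact ⟨coe_le_coe_add_of_ofReal_abs_sub_le h5, coe_le_coe_add_of_ofReal_abs_sub_le h4⟩

end

end WED

theorem theoremA6 {X : Type*} [MetricSpace X] [CompleteSpace X]
    (σ : TopologicalSpace X) (hσ : WED.CompatibleTopology σ)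
    (φ : X → EReal) (ustar : X) (A B : ℝ) (hφ : WED.LSCC σ φ ustar A B)
    (ε : ℝ) (hε : 0 < ε) (hεB : B ≤ 1 / (16 * ε)) :
    -- `V_ε` is continuous with respect to `d_φ`
    (∀ (x : ℕ → X) (y : X),
      Tendsto (fun n => WED.energyDist φ (x n) y) atTop (𝓝 0) →
      Tendsto (fun n => WED.valueFunction φ ε (x n)) atTop (𝓝 (WED.valueFunction φ ε y))) ∧
    -- `V_ε ∘ u` is absolutely continuous with the derivative bound, for every `d_φ`-absolutely
    -- continuous `u` other than a constant curve at a point where `V_ε = ∞`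
    (∀ (a b : ℝ) (u : ℝ → X), a ≤ b →
      WED.ACCurve (WED.energyDist φ) 1 (Icc a b) u →
      (¬ ∃ y, WED.valueFunction φ ε y = ⊤ ∧ ∀ t ∈ Icc a b, u t = y) →
      (∀ t ∈ Icc a b, WED.valueFunction φ ε (u t) ≠ ⊤ ∧ WED.valueFunction φ ε (u t) ≠ ⊥) ∧
      AbsolutelyContinuousOnInterval (fun t => (WED.valueFunction φ ε (u t)).toReal) a b ∧
      ∀ᵐ t ∂(volume.restrict (Ioo a b)),
        DifferentiableAt ℝ (fun r => (WED.valueFunction φ ε (u r)).toReal) t ∧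
        ENNReal.ofReal |deriv (fun r => (WED.valueFunction φ ε (u r)).toReal) t| ≤
          WED.upperSlope φ ε (u t) * WED.metricDeriv edist u t) ∧
    -- `G_ε` is a strong upper gradient of `V_ε` with respect to `d_φ`
    WED.IsStrongUpperGradient (WED.energyDist φ) (WED.valueFunction φ ε)
      (WED.upperSlope φ ε) := by
  have hS : WED.Standing φ ustar A B ε :=
    { ne_bot := hφ.ne_bot
      A_nonneg := hφ.A_nonneg
      B_nonneg := hφ.B_nonneg
      le := hφ.coercive
      eps_pos := hε
      le_eps := hεB
      -- A `d`-convergent sequence is bounded and `σ`-convergent, so the LSCC property makes `φ`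
      -- lower semicontinuous for the metric.
      lsc := WED.lowerSemicontinuous_of_seq fun u x hu =>
        hφ.lsc u x (Metric.isBounded_range_of_tendsto u hu) (WED.CompatibleTopology.tendsto hu hσ) }
  refine ⟨fun x y h => hS.tendsto_valueFunction h, fun a b u hab hu hne => ⟨fun t ht => ⟨?_,
    hS.valueFunction_ne_bot _⟩, hS.absolutelyContinuous_comp hab hu, ?_⟩, hS.isStrongUpperGradient⟩
  · exact fun hV => hne ⟨u t, hV, fun s hs => hS.eq_of_eq_top ordConnected_Icc hu ht hV hs⟩
  · rw [restrict_Ioo_eq_restrict_Icc]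
    exact hS.ae_deriv_le hab hu
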